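/- Let $G$ be a finite abelian group and let $k$ be a field whose characteristic does not divide $|G|$. Write $\widehat G=\mathrm{Hom}(G,k^\times)$. Definitions. For a finite group $H$, an $H$-algebra is a finite dimensional $k$-algebra $\Lambda$ with an action of $H$ by $k$-algebra automorphisms, and an $H$-isomorphism is a $k$-algebra isomorphism commuting with the $H$-actions. The skew-group algebra $\Lambda G$ of a $G$-algebra $\Lambda$ is $\Lambda\otimes_k kG$ with the product $(\lambda\otimes g)(\mu\otimes h)=\lambda\, g(\mu)\otimes gh$; it is a $\widehat G$-algebra through $\chi(\lambda\otimes g)=\chi(g)\lambda\otimes g$. Put $\Lambda G\widehat G=(\Lambda G)\widehat G$, regarded as a $G$-algebra through $g(x\otimes\chi)=\chi(g)\,x\otimes\chi$. For an $H$-algebra $\Lambda$ let $\mathcal D^b(\Lambda)$ be the bounded derived category of finitely generated right $\Lambda$-modules, and for $h\in H$ let $X^h=X\otimes^{\mathbf L}_\Lambda\Lambda_h$, where $\Lambda_h$ is the bimodule $\Lambda$ with its right action twisted by $h$ (that is, $x\cdot\lambda=x\,h(\lambda)$). An object $X$ is $H$-invariant if it is equipped with isomorphisms $\iota_h\colon X^{h^{-1}}\to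 X$ $(h\in H)$ such that $\iota_{gh}=\iota_g\circ(\iota_h)^{g^{-1}}$ for all $g,h\in H$; then $H$ acts on $\mathrm{End}_{\mathcal D^b(\Lambda)}(X)$ by $h.f=\iota_h\circ f^{h^{-1}}\circ\iota_h^{-1}$. An object $T$ is tilting if the smallest triangulated subcategory of $\mathcal D^b(\Lambda)$ that contains $T$ and is closed under direct summands is $\mathcal D^b(\Lambda)$ and $\mathrm{Hom}(T,T[i])=0$ for all $i\neq0$. For $H$-algebras $\Lambda,\Lambda'$ write $\mathcal D^b(\Lambda)\underset{H}{\sim}\mathcal D^b(\Lambda')$ (they are $H$-derived equivalent) if there are an $H$-invariant tilting object $T\in\mathcal D^b(\Lambda)$ and an $H$-isomorphism $\mathrm{End}_{\mathcal D^b(\Lambda)}(T)\simeq\Lambda'$. Statement. Let $\Lambda$ and $\Lambda'$ be $G$-algebras. Then $$\mathcal D^b(\Lambda)\underset{G}{\sim}\mathcal D^b(\Lambda')\ \Longrightarrow\ \mathcal D^b(\Lambda G)\underset{\widehat G}{\sim}\mathcal D^b(\Lambda'G).$$ Suppose moreover that $G$ is identified with its double dual over $k$, i.e. that the canonical map $G\to\mathrm{Hom}(\widehat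 G,k^\times)$, $g\mapsto(\chi\mapsto\chi(g))$, is bijective, and that there exist a $G$-invariant idempotent $\theta$ of $\Lambda G\widehat G$ and a $G$-invariant idempotent $\theta'$ of $\Lambda'G\widehat G$ together with $G$-isomorphisms $\Lambda\simeq\theta\,\Lambda G\widehat G\,\theta$ and $\Lambda'\simeq\theta'\,\Lambda'G\widehat G\,\theta'$. Then $$\mathcal D^b(\Lambda)\underset{G}{\sim}\mathcal D^b(\Lambda')\ \Longleftrightarrow\ \mathcal D^b(\Lambda G)\underset{\widehat G}{\sim}\mathcal D^b(\Lambda'G).$$ -/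

import Mathlib

open CategoryTheory

universe u

/-- A `G`-algebra over the field `k`: a finite dimensional associative unital `k`-algebra
with an action `ρ` of the group `G` by `k`-algebra automorphisms. -/
structure GAlgebra (k G : Type u) [Field k] [Group G] where
  /-- the underlying algebra -/
  carrier : Type u
  [ring : Ring carrier]
  [algebra : Algebra k carrier]
  [finite : FiniteDimensional k carrier]
  /-- the action of `G` by algebra automorphisms -/
  ρ : G →* (carrier ≃ₐ[k] carrier)

namespace GAlgebra

section Algebra

variable {k G : Type u} [Field k] [Group G]

instance : CoeSort (GAlgebra k G) (Type u) := ⟨carrier⟩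

attribute [instance] ring algebra finite

/-- Two `G`-algebras are `G`-isomorphic if there is a `k`-algebra isomorphism between them that
commutes with the actions of `G`. -/
def IsGIso (A B : GAlgebra k G) : Prop :=
  ∃ e : A ≃ₐ[k] B, ∀ (g : G) (a : A), e (A.ρ g a) = B.ρ g (e a)

/-- A `G`-algebra viewed as an `H`-algebra through a group homomorphism `φ : H →* G`. -/
def comap {H : Type u} [Group H] (A : GAlgebra k G) (φ : H →* G) : GAlgebra k H where
  carrier := A
  ρ := A.ρ.comp φ

/-- The action of `G` on the ring `A`, in the form needed by `SkewMonoidAlgebra`. -/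
instance (A : GAlgebra k G) : MulSemiringAction G A :=
  MulSemiringAction.compHom (M := A ≃ₐ[k] A) A A.ρ

theorem smul_def (A : GAlgebra k G) (g : G) (a : A) : g • a = A.ρ g a := rfl

instance (A : GAlgebra k G) : SMulCommClass G k A :=
  ⟨fun g c a => by simp [smul_def]⟩

/-- The skew-group algebra `A G`: it is spanned by the elements `single g a` (written `a ⊗ g`),
with the product `(a ⊗ g) (b ⊗ h) = a g(b) ⊗ g h`. -/
abbrev SkewGroupRing (A : GAlgebra k G) : Type u := SkewMonoidAlgebra A G

open SkewMonoidAlgebra in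
/-- The defining product formula, as a check of the conventions. -/
theorem skewGroupRing_mul (A : GAlgebra k G) (g h : G) (a b : A) :
    (single g a * single h b : A.SkewGroupRing) = single (g * h) (a * A.ρ g b) := by
  simp [smul_def]

open SkewMonoidAlgebra in
noncomputable instance (A : GAlgebra k G) : Algebra k A.SkewGroupRing :=
  Algebra.ofModule
    (fun c x y => by
      induction x using SkewMonoidAlgebra.induction_on' with
      | single g a =>
        induction y using SkewMonoidAlgebra.induction_on' with
        | single h b => simp [smul_single]
        | add y z hy hz => simp_all [mul_add]
      | add x z hx hz => simp_all [add_mul])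
    (fun c x y => by
      induction x using SkewMonoidAlgebra.induction_on' with
      | single g a =>
        induction y using SkewMonoidAlgebra.induction_on' with
        | single h b => simp [smul_single, smul_comm]
        | add y z hy hz => simp_all [mul_add]
      | add x z hx hz => simp_all [add_mul])

instance [Finite G] (A : GAlgebra k G) : FiniteDimensional k A.SkewGroupRing :=
  Module.Finite.equiv (SkewMonoidAlgebra.coeffLinearEquiv (S := k) (k := A) (G := G)).symm

/-- The map `a ⊗ g ↦ χ(g) a ⊗ g` of the skew-group algebra, for a character `χ` of `G`. -/
noncomputable def charFun (A : GAlgebra k G) (χ : G →* kˣ) (f : A.SkewGroupRing) : A.SkewGroupRing :=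
  ⟨Finsupp.onFinset f.support (fun g => (χ g : k) • f.coeff g) (fun g h => by
    rw [SkewMonoidAlgebra.mem_support_iff]
    rintro h0
    exact h (by rw [h0, smul_zero]))⟩

theorem coeff_charFun (A : GAlgebra k G) (χ : G →* kˣ) (f : A.SkewGroupRing) (g : G) :
    (A.charFun χ f).coeff g = (χ g : k) • f.coeff g := rfl

theorem charFun_single (A : GAlgebra k G) (χ : G →* kˣ) (g : G) (a : A) :
    A.charFun χ (SkewMonoidAlgebra.single g a) =
      SkewMonoidAlgebra.single g ((χ g : k) • a) := by
  classical
  ext h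
  rw [coeff_charFun, SkewMonoidAlgebra.coeff_single_apply, SkewMonoidAlgebra.coeff_single_apply]
  split_ifs with h1
  · rw [h1]
  · rw [smul_zero]

theorem charFun_add (A : GAlgebra k G) (χ : G →* kˣ) (x y : A.SkewGroupRing) :
    A.charFun χ (x + y) = A.charFun χ x + A.charFun χ y := by
  ext h
  simp [coeff_charFun]

theorem charFun_mul (A : GAlgebra k G) (χ : G →* kˣ) (x y : A.SkewGroupRing) :
    A.charFun χ (x * y) = A.charFun χ x * A.charFun χ y := by
  induction x using SkewMonoidAlgebra.induction_on' with
  | single g a =>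
    induction y using SkewMonoidAlgebra.induction_on' with
    | single h b =>
      simp [charFun_single, SkewMonoidAlgebra.single_mul_single, smul_comm g, smul_smul, mul_comm (χ h : k)]
    | add y z hy hz => simp_all [mul_add, charFun_add]
  | add x z hx hz => simp_all [add_mul, charFun_add]

/-- The automorphism `a ⊗ g ↦ χ(g) a ⊗ g` of the skew-group algebra. -/
noncomputable def charEquiv (A : GAlgebra k G) (χ : G →* kˣ) : A.SkewGroupRing ≃ₐ[k] A.SkewGroupRing :=
  AlgEquiv.ofLinearEquiv
    { toFun := A.charFun χ
      invFun := A.charFun χ⁻¹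
      map_add' := A.charFun_add χ
      map_smul' := fun c x => by
        ext h
        simp [coeff_charFun, smul_comm c]
      left_inv := fun x => by
        ext h
        simp [coeff_charFun, smul_smul]
      right_inv := fun x => by
        ext h
        simp [coeff_charFun, smul_smul] }
    (by
      change A.charFun χ (SkewMonoidAlgebra.single 1 1) = SkewMonoidAlgebra.single 1 1
      rw [charFun_single]
      simp)
    (A.charFun_mul χ)

/-- The skew-group algebra `A G`, as an algebra with an action of the character group
`G →* kˣ`, given by `χ (a ⊗ g) = χ(g) a ⊗ g`. -/
noncomputable def skew [Finite G] (A : GAlgebra k G) : GAlgebra k (G →* kˣ) where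
  carrier := A.SkewGroupRing
  ρ :=
    { toFun := A.charEquiv
      map_one' := by
        ext x : 1
        refine SkewMonoidAlgebra.ext fun h => ?_
        change ((1 : G →* kˣ) h : k) • x.coeff h = x.coeff h
        simp
      map_mul' := fun χ ψ => by
        ext x : 1
        refine SkewMonoidAlgebra.ext fun h => ?_
        change ((χ * ψ) h : k) • x.coeff h = (χ h : k) • (ψ h : k) • x.coeff h
        simp [smul_smul] }

/-- The defining formula for the action of the characters, as a check of the conventions. -/
theorem skew_ρ_single [Finite G] (A : GAlgebra k G) (χ : G →* kˣ) (g : G) (a : A) :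
    A.skew.ρ χ (SkewMonoidAlgebra.single g a : A.SkewGroupRing) =
      (SkewMonoidAlgebra.single g ((χ g : k) • a) : A.SkewGroupRing) :=
  A.charFun_single χ g a

/-- A finite group has finitely many characters with values in a field. -/
instance finite_characters [Finite G] : Finite (G →* kˣ) := by
  have : NeZero (Nat.card G) := ⟨Nat.card_pos.ne'⟩
  refine Finite.of_injective
    (fun (χ : G →* kˣ) (g : G) => (⟨χ g, by
      rw [mem_rootsOfUnity, ← map_pow, pow_card_eq_one', map_one]⟩ :
        rootsOfUnity (Nat.card G) k)) fun χ ψ h => MonoidHom.ext fun g => ?_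
  exact congrArg Subtype.val (congrFun h g)

/-- The canonical homomorphism from `G` to its double dual, `g ↦ (χ ↦ χ(g))`. -/
def doubleDual (k G : Type u) [Field k] [Group G] : G →* ((G →* kˣ) →* kˣ) :=
  MonoidHom.eval

/-- The iterated skew-group algebra of `A`: first with respect to `G`, then with respect to the
character group of `G`. The double dual of `G` acts on it, and `G` acts through its canonical
homomorphism to the double dual: `g (x ⊗ χ) = χ(g) x ⊗ χ`. -/
noncomputable def skewSkew [Finite G] (A : GAlgebra k G) : GAlgebra k G :=
  A.skew.skew.comap (doubleDual k G)

section Corner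

variable (A : GAlgebra k G) {θ : A} (hθ : IsIdempotentElem θ)

/-- The inclusion of the corner ring `θ A θ` into `A` (additive, multiplicative, not unital). -/
def cornerVal : hθ.Corner →+ A where
  toFun x := x.1
  map_zero' := rfl
  map_add' _ _ := rfl

theorem cornerVal_injective : Function.Injective (A.cornerVal hθ) := Subtype.val_injective

theorem cornerVal_mul (x y : hθ.Corner) :
    A.cornerVal hθ (x * y) = A.cornerVal hθ x * A.cornerVal hθ y := rfl

theorem cornerVal_one : A.cornerVal hθ 1 = θ := rfl

theorem mem_corner_smul (c : k) (x : hθ.Corner) :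
    c • A.cornerVal hθ x ∈ Subsemigroup.corner θ := by
  have hx := (Subsemigroup.mem_corner_iff hθ).1 x.2
  exact (Subsemigroup.mem_corner_iff hθ).2
    ⟨by rw [mul_smul_comm]; exact congrArg (c • ·) hx.1,
      by rw [smul_mul_assoc]; exact congrArg (c • ·) hx.2⟩

instance cornerSMul : SMul k hθ.Corner := ⟨fun c x => ⟨c • A.cornerVal hθ x,
  A.mem_corner_smul hθ c x⟩⟩

theorem cornerVal_smul (c : k) (x : hθ.Corner) :
    A.cornerVal hθ (c • x) = c • A.cornerVal hθ x := rfl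

instance cornerModule : Module k hθ.Corner :=
  (A.cornerVal_injective hθ).module k (A.cornerVal hθ) (A.cornerVal_smul hθ)

instance cornerAlgebra : Algebra k hθ.Corner :=
  Algebra.ofModule
    (fun c x y => A.cornerVal_injective hθ (by
      simp only [cornerVal_mul, cornerVal_smul, smul_mul_assoc]))
    (fun c x y => A.cornerVal_injective hθ (by
      simp only [cornerVal_mul, cornerVal_smul, mul_smul_comm]))

instance cornerFinite : FiniteDimensional k hθ.Corner :=
  Module.Finite.of_injective
    ({ A.cornerVal hθ with map_smul' := A.cornerVal_smul hθ } : hθ.Corner →ₗ[k] A)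
    (A.cornerVal_injective hθ)

theorem mem_corner_ρ (hG : ∀ g, A.ρ g θ = θ) (g : G) (x : hθ.Corner) :
    A.ρ g (A.cornerVal hθ x) ∈ Subsemigroup.corner θ := by
  have hx := (Subsemigroup.mem_corner_iff hθ).1 x.2
  have h1 := congrArg (A.ρ g) hx.1
  have h2 := congrArg (A.ρ g) hx.2
  rw [map_mul, hG g] at h1 h2
  exact (Subsemigroup.mem_corner_iff hθ).2 ⟨h1, h2⟩

/-- An element `g` of `G` acting on the corner ring `θ A θ` of a `G`-invariant idempotent. -/
def cornerHom (hG : ∀ g, A.ρ g θ = θ) (g : G) : hθ.Corner →ₐ[k] hθ.Corner :=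
  AlgHom.ofLinearMap
    { toFun := fun x => ⟨A.ρ g (A.cornerVal hθ x), A.mem_corner_ρ hθ hG g x⟩
      map_add' := fun x y => A.cornerVal_injective hθ (by
        change A.ρ g (A.cornerVal hθ (x + y)) =
          A.ρ g (A.cornerVal hθ x) + A.ρ g (A.cornerVal hθ y)
        rw [map_add, map_add])
      map_smul' := fun c x => A.cornerVal_injective hθ (by
        change A.ρ g (A.cornerVal hθ (c • x)) = c • A.ρ g (A.cornerVal hθ x)
        rw [cornerVal_smul, map_smul]) }
    (A.cornerVal_injective hθ (hG g))
    (fun x y => A.cornerVal_injective hθ (by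
      change A.ρ g (A.cornerVal hθ (x * y)) =
        A.ρ g (A.cornerVal hθ x) * A.ρ g (A.cornerVal hθ y)
      rw [cornerVal_mul, map_mul]))

theorem cornerVal_cornerHom (hG : ∀ g, A.ρ g θ = θ) (g : G) (x : hθ.Corner) :
    A.cornerVal hθ (A.cornerHom hθ hG g x) = A.ρ g (A.cornerVal hθ x) := rfl

/-- The `G`-algebra `θ A θ` (with unit `θ`) of a `G`-invariant idempotent `θ` of `A`, with the
action of `G` restricted from `A`. -/
def corner (hG : ∀ g, A.ρ g θ = θ) : GAlgebra k G where
  carrier := hθ.Corner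
  ρ := (AlgEquiv.algHomUnitsEquiv k hθ.Corner).toMonoidHom.comp (MonoidHom.toHomUnits
    { toFun := A.cornerHom hθ hG
      map_one' := AlgHom.ext fun x => A.cornerVal_injective hθ (by
        rw [cornerVal_cornerHom, map_one]; rfl)
      map_mul' := fun g h => AlgHom.ext fun x => A.cornerVal_injective hθ (by
        rw [cornerVal_cornerHom, map_mul]; rfl) })

/-- The defining formula for the action on `θ A θ`, as a check of the conventions. -/
theorem cornerVal_corner_ρ (hG : ∀ g, A.ρ g θ = θ) (g : G) (x : hθ.Corner) :
    A.cornerVal hθ ((A.corner hθ hG).ρ g x) = A.ρ g (A.cornerVal hθ x) := rfl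

end Corner


end Algebra

section Derived

variable {k G : Type u} [Field k] [Group G] (A : GAlgebra k G)

instance : IsNoetherianRing (A : Type u)ᵐᵒᵖ :=
  IsNoetherianRing.of_finite k _

/-- The abelian category `mod A` of finitely generated right `A`-modules. -/
abbrev Mod : Type (u + 1) := FGModuleCat.{u} (A : Type u)ᵐᵒᵖ

noncomputable instance : HasDerivedCategory.{u + 1} A.Mod := HasDerivedCategory.standard _

/-- The (unbounded) derived category of `mod A`. -/
abbrev D : Type (u + 1) := DerivedCategory A.Mod

/-- The bounded derived category of `mod A`, as a full subcategory of the derived category: the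
objects whose cohomology vanishes in all but finitely many degrees. -/
noncomputable abbrev Db : ObjectProperty A.D := (DerivedCategory.TStructure.t (C := A.Mod)).bounded

/-- Restriction of scalars along the automorphism `g`, on all right modules. -/
noncomputable abbrev twistMod (g : G) :
    ModuleCat.{u} (A : Type u)ᵐᵒᵖ ⥤ ModuleCat.{u} (A : Type u)ᵐᵒᵖ :=
  ModuleCat.restrictScalars (RingHom.op (A.ρ g : (A : Type u) →+* A))

theorem twistMod_isFG (g : G) (M : A.Mod) :
    ModuleCat.isFG _ ((A.twistMod g).obj M.obj) := by
  have : Module.Finite (A : Type u)ᵐᵒᵖ M.obj := M.property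
  let f : M.obj →ₛₗ[RingHom.op (A.ρ g⁻¹ : (A : Type u) →+* A)] (A.twistMod g).obj M.obj :=
    { toFun := fun m => m
      map_add' := fun _ _ => rfl
      map_smul' := fun r m => by
        have h : RingHom.op (A.ρ g : (A : Type u) →+* A)
            (RingHom.op (A.ρ g⁻¹ : (A : Type u) →+* A) r) = r := by
          change MulOpposite.op ((A.ρ g * A.ρ g⁻¹) r.unop) = r
          rw [← map_mul, mul_inv_cancel, map_one]
          rfl
        change r • m = RingHom.op (A.ρ g : (A : Type u) →+* A)
            (RingHom.op (A.ρ g⁻¹ : (A : Type u) →+* A) r) • m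
        rw [h] }
  exact Module.Finite.of_surjective f fun m => ⟨m, rfl⟩

/-- The twist functor `X ↦ X ^ g = X ⊗_A A_g` on `mod A`, where `A_g` is the bimodule `A` with right
action twisted by `g`. The map `x ↦ x ⊗ 1` identifies `X ⊗_A A_g` with the abelian group `X`
on which `a` acts as `g(a)`, i.e. with the restriction of scalars of `X` along `g`, and this is
the description used here. -/
noncomputable def twist (g : G) : A.Mod ⥤ A.Mod :=
  (ModuleCat.isFG _).lift ((ModuleCat.isFG _).ι ⋙ A.twistMod g) (A.twistMod_isFG g)

/-- The defining formula of the twist, as a check of the conventions: in `X ^ g` the element `a`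
acts on the right as `g(a)` does in `X`. -/
theorem twist_smul (g : G) (X : A.Mod) (a : A) (x : X.obj) :
    (MulOpposite.op a • (show ((A.twist g).obj X).obj from x) : ((A.twist g).obj X).obj) =
      (MulOpposite.op (A.ρ g a) • x : X.obj) := rfl

/-- The canonical isomorphism `(X ^ g) ^ h ≅ X ^ (g h)`, the identity on underlying sets. The
product `l = g h` is a separate variable in order to avoid transports. -/
noncomputable def twistComp (g h l : G) (hl : l = g * h) : A.twist g ⋙ A.twist h ≅ A.twist l :=
  NatIso.ofComponents (fun M => (ModuleCat.isFG _).isoMk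
    (ModuleCat.restrictScalarsComp'App (RingHom.op (A.ρ h : (A : Type u) →+* A))
      (RingHom.op (A.ρ g : (A : Type u) →+* A)) (RingHom.op (A.ρ l : (A : Type u) →+* A))
      (by subst hl; rw [map_mul]; rfl) M.obj).symm) (fun f => rfl)

/-- The canonical isomorphism `X ^ 1 ≅ X`, the identity on underlying sets. -/
noncomputable def twistOne : A.twist 1 ≅ 𝟭 A.Mod :=
  NatIso.ofComponents (fun M => (ModuleCat.isFG _).isoMk
    (ModuleCat.restrictScalarsId'App (RingHom.op (A.ρ 1 : (A : Type u) →+* A))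
      (by rw [map_one]; rfl) M.obj)) (fun f => rfl)

/-- The twist functors are equivalences, in particular exact. -/
instance twist_isEquivalence (g : G) : (A.twist g).IsEquivalence :=
  (CategoryTheory.Equivalence.mk (A.twist g) (A.twist g⁻¹)
    ((A.twistComp g g⁻¹ 1 (mul_inv_cancel g).symm ≪≫ A.twistOne).symm)
    (A.twistComp g⁻¹ g 1 (inv_mul_cancel g).symm ≪≫ A.twistOne)).isEquivalence_functor

instance twist_additive (g : G) : (A.twist g).Additive where
  map_add := rfl

/-- The functor `X ↦ X ^ g` on the derived category, obtained from the exact functor `twist`. -/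
noncomputable abbrev derTwist (g : G) : A.D ⥤ A.D := (A.twist g).mapDerivedCategory

/-- The canonical isomorphism `(X ^ g) ^ h ≅ X ^ (g h)` in the derived category. It is the one
induced by applying `twistComp` to complexes. -/
noncomputable def derTwistComp (g h l : G) (hl : l = g * h) :
    A.derTwist g ⋙ A.derTwist h ≅ A.derTwist l :=
  letI : Localization.Lifting DerivedCategory.Q
      (HomologicalComplex.quasiIso A.Mod (ComplexShape.up ℤ))
      (((A.twist g).mapHomologicalComplex (ComplexShape.up ℤ) ⋙
        (A.twist h).mapHomologicalComplex (ComplexShape.up ℤ)) ⋙ DerivedCategory.Q)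
      (A.derTwist g ⋙ A.derTwist h) :=
    ⟨(Functor.associator _ _ _).symm ≪≫
      Functor.isoWhiskerRight (A.twist g).mapDerivedCategoryFactors (A.derTwist h) ≪≫
      Functor.associator _ _ _ ≪≫
      Functor.isoWhiskerLeft _ (A.twist h).mapDerivedCategoryFactors ≪≫
      (Functor.associator _ _ _).symm⟩
  Localization.liftNatIso DerivedCategory.Q
    (HomologicalComplex.quasiIso A.Mod (ComplexShape.up ℤ))
    (((A.twist g).mapHomologicalComplex (ComplexShape.up ℤ) ⋙
        (A.twist h).mapHomologicalComplex (ComplexShape.up ℤ)) ⋙ DerivedCategory.Q)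
    ((A.twist l).mapHomologicalComplex (ComplexShape.up ℤ) ⋙ DerivedCategory.Q)
    (A.derTwist g ⋙ A.derTwist h) (A.derTwist l)
    (Functor.isoWhiskerRight
      (Functor.mapHomologicalComplexCompIso (A.twistComp g h l hl) (ComplexShape.up ℤ))
      DerivedCategory.Q)

/-- The structure of a `G`-invariant object on an object `X` of the derived category:
isomorphisms `ι g : X ^ (g⁻¹) ≅ X` such that `ι (g h) = ι g ∘ (ι h) ^ (g⁻¹)`, where
`(X ^ (h⁻¹)) ^ (g⁻¹)` is identified with `X ^ ((g h)⁻¹)`. -/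
structure Invariant (X : A.D) where
  /-- the isomorphisms `ι g : X ^ (g⁻¹) ≅ X` -/
  ι (g : G) : (A.derTwist g⁻¹).obj X ≅ X
  ι_mul (g h : G) :
    (A.derTwistComp h⁻¹ g⁻¹ (g * h)⁻¹ (mul_inv_rev g h)).hom.app X ≫ (ι (g * h)).hom =
      (A.derTwist g⁻¹).map (ι h).hom ≫ (ι g).hom

/-- The action `g.f = ι g ∘ f ^ (g⁻¹) ∘ (ι g)⁻¹` of `G` on the endomorphisms of a `G`-invariant
object. -/
noncomputable def Invariant.act {A : GAlgebra k G} {X : A.D} (s : A.Invariant X) (g : G)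
    (f : End X) : End X :=
  (s.ι g).inv ≫ (A.derTwist g⁻¹).map f ≫ (s.ι g).hom

/-- A tilting object of the bounded derived category: an object `T` such that the thick
subcategory `thick(T)` that it generates (the smallest triangulated subcategory closed under
direct summands that contains `T`) is the whole bounded derived category (so `T` lies in it),
and such that `Hom(T, T[i]) = 0` for all integers `i ≠ 0`. -/
structure IsTilting (T : A.D) : Prop where
  thick_eq : (ObjectProperty.singleton T).triangEnvelope = A.Db
  rigid (i : ℤ) (hi : i ≠ 0) (f : T ⟶ (shiftFunctor A.D i).obj T) : f = 0

/-- `A` and `B` are `G`-derived equivalent: there are a `G`-invariant tilting object `T` of the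
bounded derived category of `A` and an isomorphism of `k`-algebras from the endomorphism algebra of
`T` (where the product of `f` and `f'` is the composition `f ∘ f'`) to `B` that commutes with
the actions of `G`. -/
def DerEquiv (A B : GAlgebra k G) : Prop :=
  ∃ (T : A.D) (s : A.Invariant T), A.IsTilting T ∧
    ∃ e : End T ≃ₐ[k] B, ∀ (g : G) (f : End T), e (s.act g f) = B.ρ g (e f)

end Derived

end GAlgebra

/-! Let F be the induction from mod Λ to mod ΛG and H the restriction. They are adjoint on both
sides, hence exact, and pass to derived categories. F does not see twists, F(X^g) ≅ F(X); the
restriction of F(X) is the sum of the twists X^g; and since |G| is invertible, averaging makes every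
Y a retract of the induction of its restriction. Therefore Hom(FX, FY) is the direct sum over g of
Hom(X, Y^g) (`sum_coef`, `coef_self`, `coef_ne`).

For a G-invariant tilting object T the isomorphisms ι_g turn this into End(FT) = ⊕ End(T) u_g with
u_g f = (g.f) u_g, which is the skew-group algebra of End(T) (`skewLift_bijective`); a character χ
acts by u_g ↦ χ(g) u_g. The same decomposition makes FT rigid, and the retracts make it generate
(`isTilting`). This proves the first implication.

For the converse the roles are exchanged. If G embeds in its double dual, the orthogonality
relations for characters show that restriction, with the character group in place of G, satisfies
the same relations as induction. So the argument is done once, for an abstract `CrossedPair`, and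
applied to `indPair` and to `resPair`. The second application leads from ΛG ~ Λ'G to Λ ~ Λ'GĜ.

It remains to descend from Λ'GĜ to Λ'. The averaging idempotent θ = |G|⁻¹ ∑ g is invariant, its
corner is G-isomorphic to Λ' (`isGIso_corner`), and it is full (`sum_θ_eq_one`). Let T' be the image
of θ acting on the tilting object T. It exists because idempotents split in the bounded derived
category (`endSplits_of_bounded`), it inherits the invariance, and it is tilting because T is a
retract of a finite power of T' by fullness; its endomorphism algebra is the corner
(`DerEquiv.of_corner`).

The relations between F, H and the twists are checked on modules and carried to derived categories
by `dmap`, which sends a transformation of additive functors to one of the induced functors and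
respects composition, whiskering, associators and unitors. -/

namespace DerivedLift

/-! ### Transformations of functors on derived categories induced from the abelian categories. -/

open DerivedCategory Functor

universe v₁ v₂ v₃ u₁ u₂ u₃ w₁ w₂ w₃ v₄ u₄ w₄

variable {C₁ : Type u₁} [Category.{v₁} C₁] [Abelian C₁] [HasDerivedCategory.{w₁} C₁]
  {C₂ : Type u₂} [Category.{v₂} C₂] [Abelian C₂] [HasDerivedCategory.{w₂} C₂]
  {C₃ : Type u₃} [Category.{v₃} C₃] [Abelian C₃] [HasDerivedCategory.{w₃} C₃]
  {C₄ : Type u₄} [Category.{v₄} C₄] [Abelian C₄] [HasDerivedCategory.{w₄} C₄]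

/-- An isomorphism exhibiting the functor `Θ` on derived categories as the one induced by
applying the additive functor `Φ` to complexes. -/
abbrev DLift (Φ : C₁ ⥤ C₂) [Φ.Additive] (Θ : DerivedCategory C₁ ⥤ DerivedCategory C₂) :=
  Q ⋙ Θ ≅ Φ.mapHomologicalComplex (ComplexShape.up ℤ) ⋙ Q

/-- The identity functor induces the identity on complexes. -/
noncomputable def idComplexes (C : Type u₁) [Category.{v₁} C] [Abelian C] :
    𝟭 (CochainComplex C ℤ) ≅ (𝟭 C).mapHomologicalComplex (ComplexShape.up ℤ) :=
  NatIso.ofComponents (fun K => HomologicalComplex.Hom.isoOfComponents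
    (fun i => Iso.refl (K.X i)) (fun _ _ _ =>
      (Category.id_comp _).trans (Category.comp_id _).symm))
    (fun f => HomologicalComplex.hom_ext _ _ fun i =>
      (Category.comp_id (f.f i)).trans (Category.id_comp (f.f i)).symm)

@[simp]
theorem idComplexes_hom_app_f {C : Type u₁} [Category.{v₁} C] [Abelian C]
    (K : CochainComplex C ℤ) (i : ℤ) :
    ((idComplexes C).hom.app K).f i = 𝟙 (K.X i) := rfl

@[simp]
theorem idComplexes_inv_app_f {C : Type u₁} [Category.{v₁} C] [Abelian C]
    (K : CochainComplex C ℤ) (i : ℤ) :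
    ((idComplexes C).inv.app K).f i = 𝟙 (K.X i) := rfl

/-- Applying two functors to complexes is applying their composition. -/
noncomputable abbrev compComplexes (Φ : C₁ ⥤ C₂) [Φ.Additive] (Ψ : C₂ ⥤ C₃) [Ψ.Additive] :
    Φ.mapHomologicalComplex (ComplexShape.up ℤ) ⋙ Ψ.mapHomologicalComplex (ComplexShape.up ℤ) ≅
      (Φ ⋙ Ψ).mapHomologicalComplex (ComplexShape.up ℤ) :=
  Functor.mapHomologicalComplexCompIso (Iso.refl (Φ ⋙ Ψ)) (ComplexShape.up ℤ)

/-- The identity functor of the derived category is induced by the identity functor. -/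
noncomputable def idLift : DLift (𝟭 C₁) (𝟭 _) :=
  Functor.rightUnitor _ ≪≫ (Functor.leftUnitor _).symm ≪≫ isoWhiskerRight (idComplexes C₁) Q

theorem idLift_hom_app (K : CochainComplex C₁ ℤ) :
    idLift.hom.app K = Q.map ((idComplexes C₁).hom.app K) := by
  simp [idLift]

/-- The composition of two induced functors is induced by the composition. -/
noncomputable def compLift {Φ : C₁ ⥤ C₂} [Φ.Additive] {Ψ : C₂ ⥤ C₃} [Ψ.Additive]
    {Θ : DerivedCategory C₁ ⥤ DerivedCategory C₂} {Ξ : DerivedCategory C₂ ⥤ DerivedCategory C₃}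
    (a : DLift Φ Θ) (b : DLift Ψ Ξ) : DLift (Φ ⋙ Ψ) (Θ ⋙ Ξ) :=
  (Functor.associator _ _ _).symm ≪≫ isoWhiskerRight a Ξ ≪≫ Functor.associator _ _ _ ≪≫
    isoWhiskerLeft _ b ≪≫ (Functor.associator _ _ _).symm ≪≫ isoWhiskerRight (compComplexes Φ Ψ) Q

theorem compLift_hom_app {Φ : C₁ ⥤ C₂} [Φ.Additive] {Ψ : C₂ ⥤ C₃} [Ψ.Additive]
    {Θ : DerivedCategory C₁ ⥤ DerivedCategory C₂} {Ξ : DerivedCategory C₂ ⥤ DerivedCategory C₃}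
    (a : DLift Φ Θ) (b : DLift Ψ Ξ) (K : CochainComplex C₁ ℤ) :
    (compLift a b).hom.app K = Ξ.map (a.hom.app K) ≫
      b.hom.app ((Φ.mapHomologicalComplex (ComplexShape.up ℤ)).obj K) ≫
        Q.map ((compComplexes Φ Ψ).hom.app K) := by
  simp [compLift]

theorem compLift_inv_app {Φ : C₁ ⥤ C₂} [Φ.Additive] {Ψ : C₂ ⥤ C₃} [Ψ.Additive]
    {Θ : DerivedCategory C₁ ⥤ DerivedCategory C₂} {Ξ : DerivedCategory C₂ ⥤ DerivedCategory C₃}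
    (a : DLift Φ Θ) (b : DLift Ψ Ξ) (K : CochainComplex C₁ ℤ) :
    (compLift a b).inv.app K = Q.map ((compComplexes Φ Ψ).inv.app K) ≫
      b.inv.app ((Φ.mapHomologicalComplex (ComplexShape.up ℤ)).obj K) ≫
        Ξ.map (a.inv.app K) := by
  simp [compLift]

/-- The canonical lift given by the derived functor of an exact functor. -/
noncomputable abbrev derLift (Φ : C₁ ⥤ C₂) [Φ.Additive] [Limits.PreservesFiniteLimits Φ]
    [Limits.PreservesFiniteColimits Φ] : DLift Φ Φ.mapDerivedCategory :=
  Φ.mapDerivedCategoryFactors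

section

variable {Φ Ψ Λ : C₁ ⥤ C₂} [Φ.Additive] [Ψ.Additive] [Λ.Additive]
  {Θ Ξ Ω : DerivedCategory C₁ ⥤ DerivedCategory C₂}

/-- The natural transformation between induced functors on derived categories that is induced
by a natural transformation. -/
noncomputable def dmap (a : DLift Φ Θ) (b : DLift Ψ Ξ) (τ : Φ ⟶ Ψ) : Θ ⟶ Ξ :=
  (Localization.fullyFaithfulWhiskeringLeft Q
    (HomologicalComplex.quasiIso C₁ (ComplexShape.up ℤ)) _).preimage
    (X := Θ) (Y := Ξ)
    (a.hom ≫ whiskerRight (NatTrans.mapHomologicalComplex τ (ComplexShape.up ℤ)) Q ≫ b.inv)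

theorem dmap_app (a : DLift Φ Θ) (b : DLift Ψ Ξ) (τ : Φ ⟶ Ψ) (K : CochainComplex C₁ ℤ) :
    (dmap a b τ).app (Q.obj K) = a.hom.app K ≫
      Q.map ((NatTrans.mapHomologicalComplex τ (ComplexShape.up ℤ)).app K) ≫ b.inv.app K :=
  congr_app (Functor.FullyFaithful.map_preimage (Localization.fullyFaithfulWhiskeringLeft Q
    (HomologicalComplex.quasiIso C₁ (ComplexShape.up ℤ)) _) (X := Θ) (Y := Ξ) _) K

/-- The functor `Q` is a localization, so complexes detect equality. This reduces every identity
below to one about complexes. -/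
theorem natTrans_ext_Q {τ σ : Θ ⟶ Ξ} (h : ∀ K, τ.app (Q.obj K) = σ.app (Q.obj K)) : τ = σ :=
  Localization.natTrans_ext Q (HomologicalComplex.quasiIso C₁ (ComplexShape.up ℤ)) h

theorem dmap_comp (a : DLift Φ Θ) (b : DLift Ψ Ξ) (c : DLift Λ Ω) (τ : Φ ⟶ Ψ) (σ : Ψ ⟶ Λ) :
    dmap a b τ ≫ dmap b c σ = dmap a c (τ ≫ σ) :=
  natTrans_ext_Q fun K => by
    simp [dmap_app]

theorem dmap_id (a : DLift Φ Θ) : dmap a a (𝟙 Φ) = 𝟙 Θ :=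
  natTrans_ext_Q fun K => by
    simp [dmap_app]

theorem dmap_add (a : DLift Φ Θ) (b : DLift Ψ Ξ) (τ σ : Φ ⟶ Ψ) :
    dmap a b (τ + σ) = dmap a b τ + dmap a b σ :=
  natTrans_ext_Q fun K => by
    have : (NatTrans.mapHomologicalComplex (τ + σ) (ComplexShape.up ℤ)).app K =
      (NatTrans.mapHomologicalComplex τ (ComplexShape.up ℤ)).app K +
      (NatTrans.mapHomologicalComplex σ (ComplexShape.up ℤ)).app K := by
        ext; simp; rfl
    simp [dmap_app, this]

theorem dmap_zero (a : DLift Φ Θ) (b : DLift Ψ Ξ) : dmap a b 0 = 0 := by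
  have := dmap_add a b 0 0
  simpa using this

theorem dmap_sum (a : DLift Φ Θ) (b : DLift Ψ Ξ) {ι : Type*} (s : Finset ι) (τ : ι → (Φ ⟶ Ψ)) :
    dmap a b (∑ i ∈ s, τ i) = ∑ i ∈ s, dmap a b (τ i) :=
  map_sum (AddMonoidHom.mk' (dmap a b) (dmap_add a b)) τ s

theorem dmap_smul {k : Type*} [Field k] [Linear k C₁] [Linear k C₂]
    (a : DLift Φ Θ) (b : DLift Ψ Ξ) (r : k) (τ : Φ ⟶ Ψ) :
    dmap a b (r • τ) = r • dmap a b τ :=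
  natTrans_ext_Q fun K => by
    have : (NatTrans.mapHomologicalComplex (r • τ) (ComplexShape.up ℤ)).app K =
      r • (NatTrans.mapHomologicalComplex τ (ComplexShape.up ℤ)).app K := by
        ext; simp; rfl
    simp [dmap_app, this, Functor.map_smul]

/-- An isomorphism of functors induces an isomorphism of the induced functors. -/
@[simps]
noncomputable def dmapIso (a : DLift Φ Θ) (b : DLift Ψ Ξ) (e : Φ ≅ Ψ) : Θ ≅ Ξ where
  hom := dmap a b e.hom
  inv := dmap b a e.inv
  hom_inv_id := by rw [dmap_comp, e.hom_inv_id, dmap_id]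
  inv_hom_id := by rw [dmap_comp, e.inv_hom_id, dmap_id]

end

/-- The input is the naturality of `c.hom` at the map of complexes given by `τ`; the remaining
comparison maps are identities in each degree. -/
theorem whiskerRight_dmap {Φ Ψ : C₁ ⥤ C₂} [Φ.Additive] [Ψ.Additive] {Λ : C₂ ⥤ C₃} [Λ.Additive]
    {Θ Ξ : DerivedCategory C₁ ⥤ DerivedCategory C₂} {Ω : DerivedCategory C₂ ⥤ DerivedCategory C₃}
    (a : DLift Φ Θ) (b : DLift Ψ Ξ) (c : DLift Λ Ω) (τ : Φ ⟶ Ψ) :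
    whiskerRight (dmap a b τ) Ω = dmap (compLift a c) (compLift b c) (whiskerRight τ Λ) :=
  natTrans_ext_Q fun K => by
    have h := c.hom.naturality ((NatTrans.mapHomologicalComplex τ (ComplexShape.up ℤ)).app K)
    simp only [Functor.comp_map, Functor.comp_obj] at h
    have h' : (compComplexes Φ Λ).hom.app K ≫
      (NatTrans.mapHomologicalComplex (whiskerRight τ Λ) (ComplexShape.up ℤ)).app K ≫
        (compComplexes Ψ Λ).inv.app K =
      (Λ.mapHomologicalComplex (ComplexShape.up ℤ)).map
        ((NatTrans.mapHomologicalComplex τ (ComplexShape.up ℤ)).app K) := by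
      ext i
      simp
      exact (Category.id_comp _).trans (Category.comp_id _)
    rw [whiskerRight_app, dmap_app, dmap_app, compLift_hom_app, compLift_inv_app]
    simp only [Category.assoc, Functor.map_comp]
    rw [← Q.map_comp_assoc, ← Q.map_comp_assoc, Category.assoc, h', ← reassoc_of% h]
    simp

/-- Here the naturality of `dmap a b τ` itself is used, along the isomorphism `c.hom.app K`, since
the formula for `dmap` is only known on objects of the form `Q.obj`. -/
theorem whiskerLeft_dmap {Φ Ψ : C₂ ⥤ C₃} [Φ.Additive] [Ψ.Additive] {Λ : C₁ ⥤ C₂} [Λ.Additive]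
    {Θ Ξ : DerivedCategory C₂ ⥤ DerivedCategory C₃} {Ω : DerivedCategory C₁ ⥤ DerivedCategory C₂}
    (a : DLift Φ Θ) (b : DLift Ψ Ξ) (c : DLift Λ Ω) (τ : Φ ⟶ Ψ) :
    whiskerLeft Ω (dmap a b τ) = dmap (compLift c a) (compLift c b) (whiskerLeft Λ τ) :=
  natTrans_ext_Q fun K => by
    have h := (dmap a b τ).naturality (c.hom.app K)
    rw [whiskerLeft_app, dmap_app, compLift_hom_app, compLift_inv_app]
    simp only [Category.assoc]
    simp only [Functor.comp_obj] at h
    rw [dmap_app] at h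
    have h' : (compComplexes Λ Φ).hom.app K ≫
        (NatTrans.mapHomologicalComplex (whiskerLeft Λ τ) (ComplexShape.up ℤ)).app K ≫
          (compComplexes Λ Ψ).inv.app K =
        ((NatTrans.mapHomologicalComplex τ (ComplexShape.up ℤ)).app
          ((Λ.mapHomologicalComplex (ComplexShape.up ℤ)).obj K)) := by
      ext i
      simp
      exact (Category.id_comp _).trans (Category.comp_id _)
    rw [← Q.map_comp_assoc, ← Q.map_comp_assoc, Category.assoc, h']
    have h2 : Ξ.map (c.hom.app K) ≫ Ξ.map (c.inv.app K) = 𝟙 _ := by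
      rw [← Functor.map_comp, Iso.hom_inv_id_app, CategoryTheory.Functor.map_id]
    have h3 := h =≫ Ξ.map (c.inv.app K)
    simp only [Category.assoc] at h3
    rw [h3, h2]
    exact (Category.comp_id _).symm

/-- Composite functors carry composite lifts, and the two bracketings of three lifts agree up to
degreewise identities. Together with the unitor versions this lets an equation containing structural
isomorphisms be written entirely in terms of `dmap`. -/
theorem dmap_associator {Φ : C₁ ⥤ C₂} [Φ.Additive] {Ψ : C₂ ⥤ C₃} [Ψ.Additive]
    {Λ : C₃ ⥤ C₄} [Λ.Additive]
    {Θ : DerivedCategory C₁ ⥤ DerivedCategory C₂} {Ξ : DerivedCategory C₂ ⥤ DerivedCategory C₃}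
    {Ω : DerivedCategory C₃ ⥤ DerivedCategory C₄}
    (a : DLift Φ Θ) (b : DLift Ψ Ξ) (c : DLift Λ Ω) :
    dmap (compLift (compLift a b) c) (compLift a (compLift b c)) (Functor.associator Φ Ψ Λ).hom =
      (Functor.associator Θ Ξ Ω).hom :=
  natTrans_ext_Q fun K => by
    have h1 := c.hom.naturality ((compComplexes Φ Ψ).hom.app K)
    simp only [Functor.comp_map, Functor.comp_obj] at h1
    have h2 : (Λ.mapHomologicalComplex (ComplexShape.up ℤ)).map ((compComplexes Φ Ψ).hom.app K) ≫
      (compComplexes (Φ ⋙ Ψ) Λ).hom.app K ≫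
      (NatTrans.mapHomologicalComplex (Functor.associator Φ Ψ Λ).hom (ComplexShape.up ℤ)).app K =
      (compComplexes Ψ Λ).hom.app ((Φ.mapHomologicalComplex (ComplexShape.up ℤ)).obj K) ≫
        (compComplexes Φ (Ψ ⋙ Λ)).hom.app K := by
      ext i
      simp
      erw [CategoryTheory.Functor.map_id, Category.id_comp, Category.id_comp]
    have h3 : (compLift (compLift a b) c).hom.app K ≫
        Q.map ((NatTrans.mapHomologicalComplex (Functor.associator Φ Ψ Λ).hom
          (ComplexShape.up ℤ)).app K) = (compLift a (compLift b c)).hom.app K := by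
      simp only [compLift_hom_app, Functor.map_comp, Category.assoc, Functor.comp_map]
      rw [reassoc_of% h1, ← Q.map_comp, ← Q.map_comp, h2, Q.map_comp]
    rw [dmap_app, reassoc_of% h3, Iso.hom_inv_id_app]
    rfl

theorem dmap_leftUnitor {Φ : C₁ ⥤ C₂} [Φ.Additive]
    {Θ : DerivedCategory C₁ ⥤ DerivedCategory C₂} (a : DLift Φ Θ) :
    dmap (compLift idLift a) a (Functor.leftUnitor Φ).hom = (Functor.leftUnitor Θ).hom :=
  natTrans_ext_Q fun K => by
    have h := a.hom.naturality ((idComplexes C₁).hom.app K)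
    simp only [Functor.comp_map] at h
    have e : (Φ.mapHomologicalComplex (ComplexShape.up ℤ)).map ((idComplexes C₁).hom.app K) ≫
      (compComplexes (𝟭 C₁) Φ).hom.app K ≫
        (NatTrans.mapHomologicalComplex (Functor.leftUnitor Φ).hom (ComplexShape.up ℤ)).app K =
        𝟙 _ := by
      ext i
      simp
      erw [CategoryTheory.Functor.map_id, Category.id_comp, Category.id_comp]
      rfl
    rw [dmap_app, compLift_hom_app, idLift_hom_app]
    simp only [Category.assoc]
    rw [reassoc_of% h, ← Q.map_comp_assoc, ← Q.map_comp_assoc, Category.assoc, e]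
    erw [Q.map_id, Category.id_comp, Iso.hom_inv_id_app]
    rfl

theorem dmap_rightUnitor {Φ : C₁ ⥤ C₂} [Φ.Additive]
    {Θ : DerivedCategory C₁ ⥤ DerivedCategory C₂} (a : DLift Φ Θ) :
    dmap (compLift a idLift) a (Functor.rightUnitor Φ).hom = (Functor.rightUnitor Θ).hom :=
  natTrans_ext_Q fun K => by
    have e : (idComplexes C₂).hom.app ((Φ.mapHomologicalComplex (ComplexShape.up ℤ)).obj K) ≫
      (compComplexes Φ (𝟭 C₂)).hom.app K ≫
        (NatTrans.mapHomologicalComplex (Functor.rightUnitor Φ).hom (ComplexShape.up ℤ)).app K =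
        𝟙 _ := by
      ext i
      simp
      erw [Category.id_comp, Category.id_comp]
      rfl
    rw [dmap_app, compLift_hom_app, idLift_hom_app]
    simp only [Category.assoc, Functor.id_map]
    rw [← Q.map_comp_assoc, ← Q.map_comp_assoc, Category.assoc, e, Q.map_id]
    simp

theorem dmap_associator_inv {Φ : C₁ ⥤ C₂} [Φ.Additive] {Ψ : C₂ ⥤ C₃} [Ψ.Additive]
    {Λ : C₃ ⥤ C₄} [Λ.Additive]
    {Θ : DerivedCategory C₁ ⥤ DerivedCategory C₂} {Ξ : DerivedCategory C₂ ⥤ DerivedCategory C₃}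
    {Ω : DerivedCategory C₃ ⥤ DerivedCategory C₄}
    (a : DLift Φ Θ) (b : DLift Ψ Ξ) (c : DLift Λ Ω) :
    dmap (compLift a (compLift b c)) (compLift (compLift a b) c) (Functor.associator Φ Ψ Λ).inv =
      (Functor.associator Θ Ξ Ω).inv := by
  rw [← cancel_mono (Functor.associator Θ Ξ Ω).hom, Iso.inv_hom_id, ← dmap_associator a b c,
    dmap_comp, Iso.inv_hom_id, dmap_id]

end DerivedLift

namespace GAlgebra
open DerivedLift
variable {k G : Type u} [Field k] [Group G] (A : GAlgebra k G)

/-- Brings the coherence isomorphism occurring in `Invariant` into the `dmap` calculus. -/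
theorem derTwistComp_hom (g h l : G) (hl : l = g * h) :
    (A.derTwistComp g h l hl).hom =
      dmap (compLift (derLift (A.twist g)) (derLift (A.twist h))) (derLift (A.twist l))
        (A.twistComp g h l hl).hom :=
  natTrans_ext_Q fun K => by
    rw [dmap_app, compLift_hom_app]
    simp only [derTwistComp, Localization.liftNatIso_hom, Localization.liftNatTrans_app]
    have e : (Functor.mapHomologicalComplexCompIso (A.twistComp g h l hl)
          (ComplexShape.up ℤ)).hom.app K = (compComplexes (A.twist g) (A.twist h)).hom.app K ≫
        (NatTrans.mapHomologicalComplex (A.twistComp g h l hl).hom (ComplexShape.up ℤ)).app K := by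
      ext i : 1
      exact (Category.id_comp _).symm
    simp only [Iso.trans_hom, Iso.symm_hom, Functor.isoWhiskerRight_hom, Functor.isoWhiskerLeft_hom,
      NatTrans.comp_app, Functor.whiskerRight_app, Functor.whiskerLeft_app,
      Functor.associator_hom_app, Functor.associator_inv_app, Category.id_comp, Category.comp_id,
      Category.assoc, e, Functor.map_comp]
    rfl

end GAlgebra

/-! ### Crossed pairs of functors and their passage to derived categories. -/

namespace GAlgebra

open DerivedLift

variable {k Γ Γ' : Type u} [Field k] [Group Γ] [Group Γ']

/-- Functors between the module categories of a `Γ`-algebra `A` and a `Γ'`-algebra `A'` that behave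
like the induction and restriction between `A` and the skew-group algebra of `A`, for a pairing `φ`
of the groups. -/
structure CrossedPair [Fintype Γ] (A : GAlgebra k Γ) (A' : GAlgebra k Γ') (φ : Γ' →* (Γ →* kˣ)) where
  /-- the functor that plays the role of the induction -/
  F : A.Mod ⥤ A'.Mod
  /-- the functor that plays the role of the restriction -/
  H : A'.Mod ⥤ A.Mod
  [additive_F : F.Additive]
  [linear_F : F.Linear k]
  [lim_F : Limits.PreservesFiniteLimits F]
  [colim_F : Limits.PreservesFiniteColimits F]
  [additive_H : H.Additive]
  [lim_H : Limits.PreservesFiniteLimits H]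
  [colim_H : Limits.PreservesFiniteColimits H]
  /-- the unit -/
  η : 𝟭 _ ⟶ F ⋙ H
  /-- the counit -/
  ε : H ⋙ F ⟶ 𝟭 _
  /-- a section of the counit -/
  σ : 𝟭 _ ⟶ H ⋙ F
  /-- the projections of `F ⋙ H` to the twists -/
  π (g : Γ) : F ⋙ H ⟶ A.twist g
  /-- the invariance of `F` under the twists of `A` -/
  lam (g : Γ) : A.twist g ⋙ F ≅ F
  /-- the invariance of `F` under the twists of `A'` -/
  κ (χ : Γ') : F ⋙ A'.twist χ ≅ F
  triangle (X : A.Mod) : F.map (η.app X) ≫ ε.app (F.obj X) = 𝟙 _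
  section_counit (Y : A'.Mod) : σ.app Y ≫ ε.app Y = 𝟙 _
  -- This and the next two conditions say that `F ⋙ H` is the sum of the twists: completeness, in a
  -- form adjoint to a resolution of the identity, and then orthogonality.
  sum_π_lam (X : A.Mod) : ∑ g, F.map ((π g).app X) ≫ (lam g).hom.app X = ε.app (F.obj X)
  π_self (g : Γ) (X : A.Mod) : η.app ((A.twist g).obj X) ≫ H.map ((lam g).hom.app X) ≫
    (π g).app X = 𝟙 _
  π_ne (g h : Γ) (hne : g ≠ h) (X : A.Mod) : η.app ((A.twist h).obj X) ≫
    H.map ((lam h).hom.app X) ≫ (π g).app X = 0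
  lam_mul (g h l : Γ) (hl : l = g * h) (X : A.Mod) :
    F.map ((A.twistComp g h l hl).hom.app X) ≫ (lam l).hom.app X =
      (lam h).hom.app ((A.twist g).obj X) ≫ (lam g).hom.app X
  κ_mul (χ ψ l : Γ') (hl : l = χ * ψ) (X : A.Mod) :
    (A'.twistComp χ ψ l hl).hom.app (F.obj X) ≫ (κ l).hom.app X =
      (A'.twist ψ).map ((κ χ).hom.app X) ≫ (κ ψ).hom.app X
  -- The two kinds of invariance of `F` commute only up to the pairing; this scalar becomes the
  -- action of `Γ'` on the skew-group algebra.
  κ_lam (χ : Γ') (g : Γ) (X : A.Mod) :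
    (κ χ).hom.app ((A.twist g).obj X) ≫ (lam g).hom.app X =
      ((φ χ g : kˣ) : k) • ((A'.twist χ).map ((lam g).hom.app X) ≫ (κ χ).hom.app X)

namespace CrossedPair

attribute [instance] additive_F linear_F lim_F colim_F additive_H lim_H colim_H

variable [Fintype Γ] {A : GAlgebra k Γ} {A' : GAlgebra k Γ'} {φ : Γ' →* (Γ →* kˣ)}
  (S : CrossedPair A A' φ)

/-- The derived induction. -/
noncomputable abbrev DF : A.D ⥤ A'.D := S.F.mapDerivedCategory

/-- The derived restriction. -/
noncomputable abbrev DH : A'.D ⥤ A.D := S.H.mapDerivedCategory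

/-- The unit on derived categories. -/
noncomputable def dη : 𝟭 _ ⟶ S.DF ⋙ S.DH :=
  dmap idLift (compLift (derLift S.F) (derLift S.H)) S.η

/-- The counit on derived categories. -/
noncomputable def dε : S.DH ⋙ S.DF ⟶ 𝟭 _ :=
  dmap (compLift (derLift S.H) (derLift S.F)) idLift S.ε

/-- The section of the counit on derived categories. -/
noncomputable def dσ : 𝟭 _ ⟶ S.DH ⋙ S.DF :=
  dmap idLift (compLift (derLift S.H) (derLift S.F)) S.σ

/-- The projections to the twists on derived categories. -/
noncomputable def dπ (g : Γ) : S.DF ⋙ S.DH ⟶ A.derTwist g :=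
  dmap (compLift (derLift S.F) (derLift S.H)) (derLift (A.twist g)) (S.π g)

/-- The invariance of the derived induction under the twists of `A`. -/
noncomputable def dlam (g : Γ) : A.derTwist g ⋙ S.DF ≅ S.DF :=
  dmapIso (compLift (derLift (A.twist g)) (derLift S.F)) (derLift S.F) (S.lam g)

/-- The invariance of the derived induction under the twists of `A'`. -/
noncomputable def dκ (χ : Γ') : S.DF ⋙ A'.derTwist χ ≅ S.DF :=
  dmapIso (compLift (derLift S.F) (derLift (A'.twist χ))) (derLift S.F) (S.κ χ)

/-- The pattern for all the derived relations: `e` is the relation between transformations of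
functors on modules, with its structural isomorphisms made explicit, and `d` is its image under
`dmap`. -/
theorem d_triangle (X : A.D) : S.DF.map (S.dη.app X) ≫ S.dε.app (S.DF.obj X) = 𝟙 _ := by
  have e : Functor.whiskerRight S.η S.F ≫ (Functor.associator _ _ _).hom ≫
      Functor.whiskerLeft S.F S.ε ≫ (Functor.rightUnitor _).hom = (Functor.leftUnitor _).hom := by
    ext X : 2
    simpa using S.triangle X
  have d : Functor.whiskerRight S.dη S.DF ≫ (Functor.associator _ _ _).hom ≫
      Functor.whiskerLeft S.DF S.dε ≫ (Functor.rightUnitor _).hom =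
        (Functor.leftUnitor _).hom := by
    rw [← dmap_associator (derLift S.F) (derLift S.H) (derLift S.F), dε, dη,
      whiskerRight_dmap _ _ (derLift S.F), whiskerLeft_dmap _ _ (derLift S.F),
      ← dmap_leftUnitor (derLift S.F), ← dmap_rightUnitor (derLift S.F), dmap_comp, dmap_comp,
      dmap_comp, e]
  simpa using NatTrans.congr_app d X

theorem d_section_counit (Y : A'.D) : S.dσ.app Y ≫ S.dε.app Y = 𝟙 _ := by
  have e : S.σ ≫ S.ε = 𝟙 _ := by
    ext X : 2
    exact S.section_counit X
  have d : S.dσ ≫ S.dε = 𝟙 _ := by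
    rw [dσ, dε, dmap_comp, e, dmap_id]
  exact NatTrans.congr_app d Y

theorem d_sum_π_lam (X : A.D) :
    ∑ g, S.DF.map ((S.dπ g).app X) ≫ (S.dlam g).hom.app X = S.dε.app (S.DF.obj X) := by
  have e : ∑ g, Functor.whiskerRight (S.π g) S.F ≫ (S.lam g).hom =
      (Functor.associator _ _ _).hom ≫ Functor.whiskerLeft S.F S.ε ≫
        (Functor.rightUnitor _).hom := by
    ext X : 2
    rw [NatTrans.app_sum]
    simpa using S.sum_π_lam X
  have d : ∑ g, Functor.whiskerRight (S.dπ g) S.DF ≫ (S.dlam g).hom =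
      (Functor.associator _ _ _).hom ≫ Functor.whiskerLeft S.DF S.dε ≫
        (Functor.rightUnitor _).hom := by
    simp only [dπ, dlam, dmapIso_hom, dε]
    rw [← dmap_associator (derLift S.F) (derLift S.H) (derLift S.F),
      whiskerLeft_dmap _ _ (derLift S.F), ← dmap_rightUnitor (derLift S.F), dmap_comp, dmap_comp,
      ← e, dmap_sum]
    refine Finset.sum_congr rfl fun g _ => ?_
    rw [whiskerRight_dmap _ _ (derLift S.F), dmap_comp]
  have := NatTrans.congr_app d X
  rw [NatTrans.app_sum] at this
  simpa using this

theorem d_π_self (g : Γ) (X : A.D) : S.dη.app ((A.derTwist g).obj X) ≫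
    S.DH.map ((S.dlam g).hom.app X) ≫ (S.dπ g).app X = 𝟙 _ := by
  have e : Functor.whiskerLeft (A.twist g) S.η ≫ (Functor.associator _ _ _).inv ≫
      Functor.whiskerRight (S.lam g).hom S.H ≫ S.π g = (Functor.rightUnitor _).hom := by
    ext X : 2
    simpa using S.π_self g X
  have d : Functor.whiskerLeft (A.derTwist g) S.dη ≫ (Functor.associator _ _ _).inv ≫
      Functor.whiskerRight (S.dlam g).hom S.DH ≫ S.dπ g = (Functor.rightUnitor _).hom := by
    simp only [dπ, dlam, dmapIso_hom, dη]
    rw [← dmap_associator_inv (derLift (A.twist g)) (derLift S.F) (derLift S.H),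
      whiskerLeft_dmap _ _ (derLift (A.twist g)), whiskerRight_dmap _ _ (derLift S.H),
      ← dmap_rightUnitor (derLift (A.twist g)), dmap_comp, dmap_comp, dmap_comp, e]
  simpa using NatTrans.congr_app d X

theorem d_π_ne (g h : Γ) (hne : g ≠ h) (X : A.D) : S.dη.app ((A.derTwist h).obj X) ≫
    S.DH.map ((S.dlam h).hom.app X) ≫ (S.dπ g).app X = 0 := by
  have e : Functor.whiskerLeft (A.twist h) S.η ≫ (Functor.associator _ _ _).inv ≫
      Functor.whiskerRight (S.lam h).hom S.H ≫ S.π g = 0 := by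
    ext X : 2
    simpa using S.π_ne g h hne X
  have d : Functor.whiskerLeft (A.derTwist h) S.dη ≫ (Functor.associator _ _ _).inv ≫
      Functor.whiskerRight (S.dlam h).hom S.DH ≫ S.dπ g = 0 := by
    simp only [dπ, dlam, dmapIso_hom, dη]
    rw [← dmap_associator_inv (derLift (A.twist h)) (derLift S.F) (derLift S.H),
      whiskerLeft_dmap _ _ (derLift (A.twist h)), whiskerRight_dmap _ _ (derLift S.H),
      dmap_comp, dmap_comp, dmap_comp, e, dmap_zero]
  simpa using NatTrans.congr_app d X

theorem d_lam_mul (g h l : Γ) (hl : l = g * h) (X : A.D) :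
    S.DF.map ((A.derTwistComp g h l hl).hom.app X) ≫ (S.dlam l).hom.app X =
      (S.dlam h).hom.app ((A.derTwist g).obj X) ≫ (S.dlam g).hom.app X := by
  have e : Functor.whiskerRight (A.twistComp g h l hl).hom S.F ≫ (S.lam l).hom =
      (Functor.associator _ _ _).hom ≫ Functor.whiskerLeft (A.twist g) (S.lam h).hom ≫
        (S.lam g).hom := by
    ext X : 2
    simpa using S.lam_mul g h l hl X
  have d : Functor.whiskerRight (A.derTwistComp g h l hl).hom S.DF ≫ (S.dlam l).hom =
      (Functor.associator _ _ _).hom ≫ Functor.whiskerLeft (A.derTwist g) (S.dlam h).hom ≫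
        (S.dlam g).hom := by
    simp only [dlam, dmapIso_hom]
    rw [derTwistComp_hom, ← dmap_associator (derLift (A.twist g)) (derLift (A.twist h))
      (derLift S.F), whiskerLeft_dmap _ _ (derLift (A.twist g)),
      whiskerRight_dmap _ _ (derLift S.F), dmap_comp, dmap_comp, dmap_comp, e]
  simpa using NatTrans.congr_app d X

theorem d_κ_mul (χ ψ l : Γ') (hl : l = χ * ψ) (X : A.D) :
    (A'.derTwistComp χ ψ l hl).hom.app (S.DF.obj X) ≫ (S.dκ l).hom.app X =
      (A'.derTwist ψ).map ((S.dκ χ).hom.app X) ≫ (S.dκ ψ).hom.app X := by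
  have e : Functor.whiskerLeft S.F (A'.twistComp χ ψ l hl).hom ≫ (S.κ l).hom =
      (Functor.associator _ _ _).inv ≫ Functor.whiskerRight (S.κ χ).hom (A'.twist ψ) ≫
        (S.κ ψ).hom := by
    ext X : 2
    simpa using S.κ_mul χ ψ l hl X
  have d : Functor.whiskerLeft S.DF (A'.derTwistComp χ ψ l hl).hom ≫ (S.dκ l).hom =
      (Functor.associator _ _ _).inv ≫ Functor.whiskerRight (S.dκ χ).hom (A'.derTwist ψ) ≫
        (S.dκ ψ).hom := by
    simp only [dκ, dmapIso_hom]
    rw [derTwistComp_hom, ← dmap_associator_inv (derLift S.F) (derLift (A'.twist χ))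
      (derLift (A'.twist ψ)), whiskerLeft_dmap _ _ (derLift S.F),
      whiskerRight_dmap _ _ (derLift (A'.twist ψ)), dmap_comp, dmap_comp, dmap_comp, e]
  simpa using NatTrans.congr_app d X

theorem d_κ_lam (χ : Γ') (g : Γ) (X : A.D) :
    (S.dκ χ).hom.app ((A.derTwist g).obj X) ≫ (S.dlam g).hom.app X =
      ((φ χ g : kˣ) : k) • ((A'.derTwist χ).map ((S.dlam g).hom.app X) ≫ (S.dκ χ).hom.app X) := by
  have e : (Functor.associator _ _ _).hom ≫ Functor.whiskerLeft (A.twist g) (S.κ χ).hom ≫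
      (S.lam g).hom = ((φ χ g : kˣ) : k) •
        (Functor.whiskerRight (S.lam g).hom (A'.twist χ) ≫ (S.κ χ).hom) := by
    ext X : 2
    simpa using S.κ_lam χ g X
  have d : (Functor.associator _ _ _).hom ≫ Functor.whiskerLeft (A.derTwist g) (S.dκ χ).hom ≫
      (S.dlam g).hom = ((φ χ g : kˣ) : k) •
        (Functor.whiskerRight (S.dlam g).hom (A'.derTwist χ) ≫ (S.dκ χ).hom) := by
    simp only [dlam, dκ, dmapIso_hom]
    rw [← dmap_associator (derLift (A.twist g)) (derLift S.F) (derLift (A'.twist χ)),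
      whiskerLeft_dmap _ _ (derLift (A.twist g)), whiskerRight_dmap _ _ (derLift (A'.twist χ)),
      dmap_comp, dmap_comp, dmap_comp, e, dmap_smul]
  simpa using NatTrans.congr_app d X

end CrossedPair
end GAlgebra

/-! ### Boundedness and thick subcategories under exact functors. -/

namespace GAlgebra

open DerivedLift

section Bounded

universe v₁ v₂ u₁ u₂ w₁ w₂

variable {C₁ : Type u₁} [Category.{v₁} C₁] [Abelian C₁] [HasDerivedCategory.{w₁} C₁]
  {C₂ : Type u₂} [Category.{v₂} C₂] [Abelian C₂] [HasDerivedCategory.{w₂} C₂]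

open DerivedCategory in
-- The bounds are detected by vanishing of cohomology, and the cohomology of a retract is a
-- subobject of the cohomology.
instance bounded_isStableUnderRetracts :
    (TStructure.t (C := C₁)).bounded.IsStableUnderRetracts where
  of_retract {X Y} r hY := by
    obtain ⟨⟨n, hn⟩, ⟨m, hm⟩⟩ := hY
    refine ⟨⟨n, ?_⟩, ⟨m, ?_⟩⟩
    · have hn' := (isGE_iff Y n).1 hn
      refine (isGE_iff X n).2 fun i hi => ?_
      exact (hn' i hi).of_mono (r.map (homologyFunctor C₁ i)).i
    · have hm' := (isLE_iff Y m).1 hm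
      refine (isLE_iff X m).2 fun i hi => ?_
      exact (hm' i hi).of_mono (r.map (homologyFunctor C₁ i)).i

open DerivedCategory in
-- The lower and the upper bound are witnessed by two possibly different complexes; each bound
-- survives applying `F` degreewise.
theorem bounded_mapDerivedCategory (F : C₁ ⥤ C₂) [F.Additive] [Limits.PreservesFiniteLimits F]
    [Limits.PreservesFiniteColimits F] {X : DerivedCategory C₁}
    (hX : (TStructure.t (C := C₁)).bounded X) :
    (TStructure.t (C := C₂)).bounded (F.mapDerivedCategory.obj X) := by
  obtain ⟨⟨n, ⟨K, e, hK⟩⟩, ⟨m, ⟨L, e', hL⟩⟩⟩ := hX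
  refine ⟨⟨n, ⟨(F.mapHomologicalComplex (ComplexShape.up ℤ)).obj K,
    F.mapDerivedCategory.mapIso e ≪≫ F.mapDerivedCategoryFactors.app K, ?_⟩⟩,
    ⟨m, ⟨(F.mapHomologicalComplex (ComplexShape.up ℤ)).obj L,
    F.mapDerivedCategory.mapIso e' ≪≫ F.mapDerivedCategoryFactors.app L, ?_⟩⟩⟩
  · infer_instance
  · infer_instance

end Bounded

section Triangulated

universe v₁ v₂ u₁ u₂

open Limits Pretriangulated ZeroObject

theorem inverseImage_isStableUnderRetracts {C : Type u₁} [Category.{v₁} C] {D : Type u₂}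
    [Category.{v₂} D] (F : C ⥤ D) (P : ObjectProperty D)
    [P.IsStableUnderRetracts] : (P.inverseImage F).IsStableUnderRetracts where
  of_retract r h := P.prop_of_retract (r.map F) h

variable {C : Type u₁} [Category.{v₁} C] [HasZeroObject C] [HasShift C ℤ] [Preadditive C]
  [∀ n : ℤ, (shiftFunctor C n).Additive] [Pretriangulated C]
  {D : Type u₂} [Category.{v₂} D] [HasZeroObject D] [HasShift D ℤ] [Preadditive D]
  [∀ n : ℤ, (shiftFunctor D n).Additive] [Pretriangulated D]

theorem inverseImage_isTriangulated (F : C ⥤ D) [F.CommShift ℤ] [F.IsTriangulated]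
    (P : ObjectProperty D) [P.IsTriangulated] [P.IsClosedUnderIsomorphisms] :
    (P.inverseImage F).IsTriangulated where
  exists_zero := ⟨0, isZero_zero C, P.prop_of_isZero (F.map_isZero (isZero_zero C))⟩
  isStableUnderShiftBy n :=
    { le_shift := fun X hX => P.prop_of_iso ((F.commShiftIso n).app X).symm
        (P.le_shift n _ hX) }
  ext₂' T hT h₁ h₃ := by
    refine (ObjectProperty.le_isoClosure _) _ ?_
    exact P.ext_of_isTriangulatedClosed₂ _ (F.map_distinguished T hT) h₁ h₃

/-- A triangulated functor maps the thick subcategory of an object to the thick subcategory of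
its image. -/
theorem map_triangEnvelope (F : C ⥤ D) [F.CommShift ℤ] [F.IsTriangulated] [IsTriangulated D]
    (T X : C) (h : (ObjectProperty.singleton T).triangEnvelope X) :
    (ObjectProperty.singleton (F.obj T)).triangEnvelope (F.obj X) := by
  have := inverseImage_isTriangulated F (ObjectProperty.singleton (F.obj T)).triangEnvelope
  have := inverseImage_isStableUnderRetracts F (ObjectProperty.singleton (F.obj T)).triangEnvelope
  refine (ObjectProperty.triangEnvelope_le_iff _
    (Q := (ObjectProperty.singleton (F.obj T)).triangEnvelope.inverseImage F)).2 ?_ _ h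
  rintro _ ⟨⟩
  exact ObjectProperty.le_triangEnvelope _ _ (by simp)

end Triangulated

theorem Invariant.act_add {k Γ : Type u} [Field k] [Group Γ] {A : GAlgebra k Γ}
    {T : A.D} (s : A.Invariant T) (g : Γ) (f f' : End T) :
    s.act g (f + f') = s.act g f + s.act g f' := by
  change _ ≫ _ ≫ _ = _ ≫ _ ≫ _ + _ ≫ _ ≫ _
  rw [← Preadditive.comp_add, ← Preadditive.add_comp]
  congr 2
  exact Functor.map_add _

theorem Invariant.act_mul {k Γ : Type u} [Field k] [Group Γ] {A : GAlgebra k Γ}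
    {T : A.D} (s : A.Invariant T) (g : Γ) (f f' : End T) :
    s.act g (f * f') = s.act g f * s.act g f' := by
  change (s.ι g).inv ≫ (A.derTwist g⁻¹).map (f' ≫ f) ≫ (s.ι g).hom =
    ((s.ι g).inv ≫ (A.derTwist g⁻¹).map f' ≫ (s.ι g).hom) ≫
      ((s.ι g).inv ≫ (A.derTwist g⁻¹).map f ≫ (s.ι g).hom)
  simp

/-! ### The induced object: tilting property and endomorphism algebra. -/

namespace CrossedPair

variable {k Γ Γ' : Type u} [Field k] [Group Γ] [Group Γ']
variable [Fintype Γ] {A : GAlgebra k Γ} {A' : GAlgebra k Γ'} {φ : Γ' →* (Γ →* kˣ)}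
  (S : CrossedPair A A' φ)

/-- The components of a morphism between induced objects. -/
noncomputable def coef {X Y : A.D} (g : Γ) (f : S.DF.obj X ⟶ S.DF.obj Y) :
    X ⟶ (A.derTwist g).obj Y :=
  S.dη.app X ≫ S.DH.map f ≫ (S.dπ g).app Y

/-- The counit recovers `f` from its adjoint, by naturality and the triangle identity, and the
counit splits as a sum over the group. With `coef_self` and `coef_ne` this is the decomposition of
Hom(FX, FY) as the sum of the Hom(X, Y^g). -/
theorem sum_coef {X Y : A.D} (f : S.DF.obj X ⟶ S.DF.obj Y) :
    ∑ g, S.DF.map (S.coef g f) ≫ (S.dlam g).hom.app Y = f := by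
  have h1 : ∀ g, S.DF.map (S.coef g f) ≫ (S.dlam g).hom.app Y =
      S.DF.map (S.dη.app X) ≫ S.DF.map (S.DH.map f) ≫
        S.DF.map ((S.dπ g).app Y) ≫ (S.dlam g).hom.app Y := fun g => by
    rw [coef, Functor.map_comp, Functor.map_comp, Category.assoc, Category.assoc]
  rw [Finset.sum_congr rfl fun g _ => h1 g, ← Preadditive.comp_sum,
    ← Preadditive.comp_sum, S.d_sum_π_lam]
  have h2 := S.dε.naturality f
  simp only [Functor.comp_map, Functor.id_map] at h2
  rw [h2, ← Category.assoc, S.d_triangle, Category.id_comp]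

theorem coef_map_comp {X Y : A.D} (g h : Γ) (a : X ⟶ (A.derTwist h).obj Y) :
    S.coef g (S.DF.map a ≫ (S.dlam h).hom.app Y) =
      a ≫ S.dη.app _ ≫ S.DH.map ((S.dlam h).hom.app Y) ≫ (S.dπ g).app Y := by
  have h2 := S.dη.naturality a
  simp only [Functor.comp_map, Functor.id_map] at h2
  rw [coef, Functor.map_comp, Category.assoc, ← reassoc_of% h2]

theorem coef_self {X Y : A.D} (g : Γ) (a : X ⟶ (A.derTwist g).obj Y) :
    S.coef g (S.DF.map a ≫ (S.dlam g).hom.app Y) = a := by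
  rw [coef_map_comp, S.d_π_self]
  exact Category.comp_id _

theorem coef_ne {X Y : A.D} (g h : Γ) (hne : g ≠ h) (a : X ⟶ (A.derTwist h).obj Y) :
    S.coef g (S.DF.map a ≫ (S.dlam h).hom.app Y) = 0 := by
  rw [coef_map_comp, S.d_π_ne g h hne, Limits.comp_zero]

theorem coef_sum {X Y : A.D} (g : Γ) {ι : Type*} (t : Finset ι)
    (f : ι → (S.DF.obj X ⟶ S.DF.obj Y)) :
    S.coef g (∑ i ∈ t, f i) = ∑ i ∈ t, S.coef g (f i) := by
  simp only [coef]
  rw [Functor.map_sum, Preadditive.sum_comp, Preadditive.comp_sum]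

variable {T : A.D} (s : A.Invariant T)

/-- The unit of the endomorphism algebra of the induced object given by a group element. -/
noncomputable def unitIso (g : Γ) : S.DF.obj T ≅ S.DF.obj T :=
  ((S.dlam g⁻¹).app T).symm ≪≫ S.DF.mapIso (s.ι g)

/-- The endomorphism of the induced object given by a group element. -/
noncomputable def unit (g : Γ) : End (S.DF.obj T) := (S.unitIso s g).hom

theorem unit_eq (g : Γ) :
    S.unit s g = (S.dlam g⁻¹).inv.app T ≫ S.DF.map (s.ι g).hom := rfl

/-- The cocycle conditions for `ι` and for `dlam` involve the same isomorphism `derTwistComp`, which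
cancels. Products in `End` are compositions in the reverse order. -/
theorem unit_mul (g h : Γ) : S.unit s (g * h) = S.unit s g * S.unit s h := by
  change _ = S.unit s h ≫ S.unit s g
  have h1 := S.d_lam_mul h⁻¹ g⁻¹ (g * h)⁻¹ (mul_inv_rev g h) T
  have h2 := (S.dlam g⁻¹).inv.naturality (s.ι h).hom
  simp only [Functor.comp_map] at h2
  have h3 := congrArg S.DF.map (s.ι_mul g h)
  rw [Functor.map_comp, Functor.map_comp] at h3
  rw [unit_eq, unit_eq, unit_eq, Category.assoc, reassoc_of% h2, ← h3]
  have h4 : (S.dlam (g * h)⁻¹).inv.app T = (S.dlam h⁻¹).inv.app T ≫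
      (S.dlam g⁻¹).inv.app ((A.derTwist h⁻¹).obj T) ≫
        S.DF.map ((A.derTwistComp h⁻¹ g⁻¹ (g * h)⁻¹ (mul_inv_rev g h)).hom.app T) := by
    rw [← cancel_mono ((S.dlam (g * h)⁻¹).hom.app T), Category.assoc, Category.assoc, h1,
      Iso.inv_hom_id_app, Iso.inv_hom_id_app_assoc, Iso.inv_hom_id_app]
  rw [h4, Category.assoc, Category.assoc]

/-- No normalization of `ι 1` is part of `Invariant`; it follows because an idempotent isomorphism
is the identity. -/
theorem unit_one : S.unit s 1 = 1 := by
  have h : S.unit s 1 ≫ S.unit s 1 = S.unit s 1 := by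
    have := S.unit_mul s 1 1
    rw [mul_one] at this
    exact this.symm
  have h2 : S.unit s 1 = (S.unitIso s 1).hom := rfl
  rw [h2] at h ⊢
  rw [← cancel_mono (S.unitIso s 1).hom, h]
  exact (Category.id_comp _).symm

/-- The group homomorphism to the endomorphism algebra of the induced object. -/
noncomputable def unitHom : Γ →* End (S.DF.obj T) where
  toFun := S.unit s
  map_one' := S.unit_one s
  map_mul' := S.unit_mul s

/-- Naturality of `dlam` and the definition of the action. In the multiplication of `End` this is
the skew relation u_g f = (g.f) u_g. -/
theorem unit_comm (g : Γ) (f : End T) :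
    S.DF.map f ≫ S.unit s g = S.unit s g ≫ S.DF.map (s.act g f) := by
  have h2 := (S.dlam g⁻¹).inv.naturality f
  simp only [Functor.comp_map] at h2
  rw [unit_eq, reassoc_of% h2, Category.assoc, ← Functor.map_comp, ← Functor.map_comp,
    Invariant.act, Iso.hom_inv_id_assoc]

/-- The structure of an invariant object on an induced object. -/
noncomputable def invariant : A'.Invariant (S.DF.obj T) where
  ι χ := (S.dκ χ⁻¹).app T
  ι_mul χ ψ := S.d_κ_mul ψ⁻¹ χ⁻¹ (χ * ψ)⁻¹ (mul_inv_rev χ ψ) T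

theorem invariant_act_map (χ : Γ') (f : End T) :
    (S.invariant (T := T)).act χ (S.DF.map f) = S.DF.map f := by
  have h := (S.dκ χ⁻¹).hom.naturality f
  simp only [Functor.comp_map] at h
  change (S.dκ χ⁻¹).inv.app T ≫ (A'.derTwist χ⁻¹).map (S.DF.map f) ≫ (S.dκ χ⁻¹).hom.app T = _
  rw [h, Iso.inv_hom_id_app_assoc]

theorem invariant_act_unit (χ : Γ') (g : Γ) :
    (S.invariant (T := T)).act χ (S.unit s g) = ((φ χ g : kˣ) : k) • S.unit s g := by
  have h1 := S.d_κ_lam χ⁻¹ g⁻¹ T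
  -- The invariant structures use twists by inverses on both sides, and the two inversions cancel in
  -- the pairing.
  have hs : ((φ χ⁻¹ g⁻¹ : kˣ) : k) = φ χ g := by
    rw [map_inv, map_inv, MonoidHom.inv_apply, inv_inv]
  rw [hs] at h1
  have h2 : (A'.derTwist χ⁻¹).map ((S.dlam g⁻¹).inv.app T) ≫
      (S.dκ χ⁻¹).hom.app ((A.derTwist g⁻¹).obj T) = ((φ χ g : kˣ) : k) •
        ((S.dκ χ⁻¹).hom.app T ≫ (S.dlam g⁻¹).inv.app T) := by
    rw [← cancel_mono ((S.dlam g⁻¹).hom.app T), Category.assoc, h1, Linear.comp_smul,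
      Linear.smul_comp, ← Functor.map_comp_assoc, Iso.inv_hom_id_app, Category.assoc,
      Iso.inv_hom_id_app, CategoryTheory.Functor.map_id, Category.comp_id]
    exact congrArg _ (Category.id_comp _)
  have h3 := (S.dκ χ⁻¹).hom.naturality (s.ι g).hom
  simp only [Functor.comp_map] at h3
  change (S.dκ χ⁻¹).inv.app T ≫ (A'.derTwist χ⁻¹).map (S.unit s g) ≫ (S.dκ χ⁻¹).hom.app T = _
  rw [unit_eq, Functor.map_comp, Category.assoc, h3, reassoc_of% h2, Linear.smul_comp,
    Linear.comp_smul, Category.assoc, Iso.inv_hom_id_app_assoc]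

/-- Generation: a bounded `Y` is a retract of the induction of its restriction, and that restriction
is in the thick subcategory of `T`. Rigidity: the components of a map to a shift of the induced
object are maps from `T` to twists of T[i], that is to T[i] by invariance. -/
theorem isTilting (hT : A.IsTilting T) (s : A.Invariant T) : A'.IsTilting (S.DF.obj T) where
  thick_eq := by
    apply le_antisymm
    · refine (ObjectProperty.triangEnvelope_le_iff _).2 ?_
      rintro _ ⟨⟩
      refine bounded_mapDerivedCategory S.F ?_
      change A.Db T
      rw [← hT.thick_eq]
      exact ObjectProperty.le_triangEnvelope _ _ (by simp)
    · intro Y hY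
      have h1 : A.Db (S.DH.obj Y) := bounded_mapDerivedCategory S.H hY
      rw [← hT.thick_eq] at h1
      exact ObjectProperty.prop_of_retract _
        (Retract.mk (S.dσ.app Y) (S.dε.app Y) (S.d_section_counit Y))
        (map_triangEnvelope S.DF T _ h1)
  rigid i hi f := by
    have h0 : ∀ (g : Γ) (a : T ⟶ (A.derTwist g).obj ((shiftFunctor A.D i).obj T)), a = 0 := by
      intro g a
      obtain ⟨e⟩ : Nonempty ((A.derTwist g).obj T ≅ T) := by
        have := s.ι g⁻¹
        rw [inv_inv] at this
        exact ⟨this⟩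
      have := hT.rigid i hi (a ≫ ((A.derTwist g).commShiftIso i).hom.app T ≫
        (shiftFunctor A.D i).map e.hom)
      rw [← cancel_mono (((A.derTwist g).commShiftIso i).hom.app T ≫
        (shiftFunctor A.D i).map e.hom), this, Limits.zero_comp]
    rw [← cancel_mono ((S.DF.commShiftIso i).inv.app T), Limits.zero_comp,
      ← S.sum_coef (f ≫ (S.DF.commShiftIso i).inv.app T)]
    refine Finset.sum_eq_zero fun g _ => ?_
    rw [h0 g (S.coef g _), Functor.map_zero, Limits.zero_comp]

/-- The ring homomorphism between endomorphism rings given by the induction. -/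
noncomputable def mapEnd : End T →+* End (S.DF.obj T) where
  toFun f := S.DF.map f
  map_one' := S.DF.map_id T
  map_mul' f g := S.DF.map_comp g f
  map_zero' := S.DF.map_zero _ _
  map_add' _ _ := S.DF.map_add

section SkewLift

variable {B : GAlgebra k Γ} (e : End T ≃ₐ[k] B)
  (he : ∀ (g : Γ) (f : End T), e (s.act g f) = B.ρ g (e f))

/-- The homomorphism from a skew-group algebra to the endomorphism algebra of the induced
object. -/
noncomputable def skewLift : B.SkewGroupRing →+* End (S.DF.obj T) :=
  SkewMonoidAlgebra.liftNCRingHom ((S.mapEnd (T := T)).comp (e.symm : B →+* End T))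
    (S.unitHom s) (fun {x y} => by
      have h := S.unit_comm s y (e.symm x)
      have h2 : s.act y (e.symm x) = e.symm (y • x) := by
        rw [AlgEquiv.eq_symm_apply, he, AlgEquiv.apply_symm_apply, smul_def]
      rw [h2] at h
      exact h.symm)

theorem skewLift_single (g : Γ) (b : B) :
    S.skewLift s e he (SkewMonoidAlgebra.single g b) =
      S.unit s g ≫ S.DF.map (e.symm b) :=
  SkewMonoidAlgebra.liftNC_single _ _ _ _

theorem skewLift_apply (x : B.SkewGroupRing) :
    S.skewLift s e he x = ∑ g, S.unit s g ≫ S.DF.map (e.symm (x.coeff g)) := by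
  classical
  induction x using SkewMonoidAlgebra.induction_on' with
  | single h b =>
    rw [skewLift_single, Finset.sum_eq_single h]
    · rw [SkewMonoidAlgebra.coeff_single_apply, if_pos rfl]
    · intro g _ hg
      rw [SkewMonoidAlgebra.coeff_single_apply, if_neg hg.symm, map_zero]
      exact (congrArg _ (Functor.map_zero _ _ _)).trans Limits.comp_zero
    · simp
  | add x y hx hy =>
    rw [map_add, hx, hy, ← Finset.sum_add_distrib]
    refine Finset.sum_congr rfl fun g _ => ?_
    rw [SkewMonoidAlgebra.coeff_add, Finsupp.add_apply, map_add, ← Preadditive.comp_add]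
    exact congrArg _ (Functor.map_add _).symm

theorem unit_inv_eq (g : Γ) :
    S.unit s g⁻¹ = S.DF.map (s.ι g).inv ≫ (S.dlam g⁻¹).hom.app T := by
  have h : S.unit s g ≫ S.unit s g⁻¹ = 𝟙 _ := by
    have := S.unit_mul s g⁻¹ g
    rw [inv_mul_cancel, unit_one] at this
    exact this.symm
  rw [← cancel_epi (S.unitIso s g).hom]
  refine Eq.trans h ?_
  change _ = S.unit s g ≫ _
  rw [unit_eq, Category.assoc, ← Functor.map_comp_assoc, Iso.hom_inv_id,
    CategoryTheory.Functor.map_id, Category.id_comp, Iso.inv_hom_id_app]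

-- Deduced from the action on `B` by transport along `e`, which avoids a computation with the
-- cocycle condition.
omit [Fintype Γ] in
include he in
theorem act_act_inv (g : Γ) (f : End T) : s.act g (s.act g⁻¹ f) = f := by
  apply e.injective
  rw [he, he, ← AlgEquiv.mul_apply, ← map_mul, mul_inv_cancel, map_one, AlgEquiv.one_apply]

-- Puts a term of the skew-group algebra in the form `S.DF.map a ≫ dlam`, whose components are known
-- from `coef_self` and `coef_ne`.
include he in
theorem unit_inv_comp_map (g : Γ) (f : End T) : S.unit s g⁻¹ ≫ S.DF.map f =
    S.DF.map (s.act g f ≫ (s.ι g).inv) ≫ (S.dlam g⁻¹).hom.app T := by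
  have h := S.unit_comm s g⁻¹ (s.act g f)
  have h2 : s.act g⁻¹ (s.act g f) = f := by
    have := act_act_inv s e he g⁻¹ f
    rwa [inv_inv] at this
  rw [h2] at h
  rw [← h, unit_inv_eq, Functor.map_comp, Category.assoc]

/-- Each coefficient of an element is recovered from the component of its image in the corresponding
twist, so injectivity is orthogonality and surjectivity is `sum_coef`. -/
theorem skewLift_bijective : Function.Bijective (S.skewLift s e he) := by
  constructor
  · rw [injective_iff_map_eq_zero]
    intro x hx
    refine SkewMonoidAlgebra.ext fun h => ?_
    obtain ⟨h, rfl⟩ : ∃ h' : Γ, h'⁻¹ = h := ⟨h⁻¹, inv_inv h⟩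
    -- Reindexing by inverses matches `ι g`, whose source is the twist by `g⁻¹`.
    rw [skewLift_apply, ← Equiv.sum_comp (Equiv.inv Γ)] at hx
    have h1 := congrArg (S.coef h⁻¹) hx
    rw [coef_sum, Finset.sum_eq_single h] at h1
    · simp only [Equiv.inv_apply] at h1
      rw [S.unit_inv_comp_map s e he, coef_self] at h1
      have h2 : S.coef (X := T) (Y := T) h⁻¹ 0 = 0 := by
        rw [coef, Functor.map_zero, Limits.zero_comp, Limits.comp_zero]
      replace h1 := h1.trans h2
      have h3 : s.act h (e.symm (x.coeff h⁻¹)) = 0 := by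
        rw [← cancel_mono (s.ι h).inv]
        exact h1.trans Limits.zero_comp.symm
      have h4 := he h (e.symm (x.coeff h⁻¹))
      rw [h3, map_zero, AlgEquiv.apply_symm_apply] at h4
      simpa using h4.symm
    · intro g _ hg
      simp only [Equiv.inv_apply]
      rw [S.unit_inv_comp_map s e he, coef_ne]
      exact fun hh => hg (inv_injective hh).symm
    · simp
  · intro f
    suffices f ∈ (S.skewLift s e he).range from this
    rw [← S.sum_coef f, ← Equiv.sum_comp (Equiv.inv Γ)]
    refine sum_mem (M := End (S.DF.obj T)) fun g _ => ?_
    -- Composing the component with `ι g` makes it an endomorphism of `T`; the action of `g⁻¹`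
    -- undoes the one produced by moving it past the unit.
    refine ⟨SkewMonoidAlgebra.single g⁻¹ (e (s.act g⁻¹ (S.coef g⁻¹ f ≫ (s.ι g).hom))), ?_⟩
    rw [skewLift_single, AlgEquiv.symm_apply_apply, S.unit_inv_comp_map s e he,
      act_act_inv s e he, Category.assoc, Iso.hom_inv_id, Category.comp_id]
    rfl

theorem act_skewLift (χ : Γ') (x : B.SkewGroupRing) :
    (S.invariant (T := T)).act χ (S.skewLift s e he x) =
      S.skewLift s e he (B.charFun (φ χ) x) := by
  induction x using SkewMonoidAlgebra.induction_on' with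
  | single h b =>
    rw [charFun_single, skewLift_single, skewLift_single]
    refine ((S.invariant (T := T)).act_mul χ (S.DF.map (e.symm b)) (S.unit s h)).trans ?_
    rw [invariant_act_map, invariant_act_unit, map_smul]
    change (_ • S.unit s h) ≫ _ = _
    rw [Linear.smul_comp, Functor.map_smul, Linear.comp_smul]
  | add x y hx hy =>
    rw [charFun_add, map_add, map_add, Invariant.act_add, hx, hy]

/-- The isomorphism from a skew-group algebra to the endomorphism algebra of the induced object. -/
noncomputable def skewLiftEquiv : B.SkewGroupRing ≃ₐ[k] End (S.DF.obj T) :=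
  AlgEquiv.ofBijective (AlgHom.ofLinearMap
    { toFun := S.skewLift s e he
      map_add' := map_add _
      map_smul' := fun c x => by
        simp only [skewLift_apply, RingHom.id_apply]
        rw [Finset.smul_sum]
        refine Finset.sum_congr rfl fun g _ => ?_
        rw [SkewMonoidAlgebra.coeff_smul, Finsupp.smul_apply, map_smul]
        refine Eq.trans (congrArg _ (Functor.map_smul _ _ _)) (Linear.comp_smul (R := k) _ _ _ _ _ _) }
    (map_one (S.skewLift s e he)) (map_mul (S.skewLift s e he))) (S.skewLift_bijective s e he)

end SkewLift

include S in
/-- Induction preserves derived equivalences, up to passing to the skew-group algebra. -/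
theorem derEquiv (B : GAlgebra k Γ) (h : A.DerEquiv B) : A'.DerEquiv (B.skew.comap φ) := by
  obtain ⟨T, s, hT, e, he⟩ := h
  refine ⟨S.DF.obj T, S.invariant, S.isTilting hT s, (S.skewLiftEquiv s e he).symm, ?_⟩
  intro χ f
  obtain ⟨x, rfl⟩ := (S.skewLiftEquiv s e he).surjective f
  refine (AlgEquiv.symm_apply_eq (S.skewLiftEquiv s e he)).2 ((S.act_skewLift s e he χ x).trans ?_)
  exact congrArg (fun y => S.skewLift s e he (B.charFun (φ χ) y))
    ((S.skewLiftEquiv s e he).symm_apply_apply x).symm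

end CrossedPair
end GAlgebra

/-! ### Induction and restriction of modules for a skew-group algebra. -/

namespace GAlgebra

open MulOpposite

section Mod

variable {k G : Type u} [Field k] [Group G] {A : GAlgebra k G}

/-- The morphism of `mod A` given by a linear map. -/
def mkHom {M N : A.Mod} (f : M.obj →ₗ[(A : Type u)ᵐᵒᵖ] N.obj) : M ⟶ N :=
  ObjectProperty.homMk (ModuleCat.ofHom f)

theorem mod_hom_ext {M N : A.Mod} {f g : M ⟶ N} (h : ∀ m : M.obj, f.hom.hom m = g.hom.hom m) :
    f = g :=
  FGModuleCat.hom_ext (LinearMap.ext h)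

theorem smul_hom_apply {M N : A.Mod} (c : k) (f : M ⟶ N) (m : M.obj) :
    (c • f).hom.hom m = op (c • (1 : A)) • f.hom.hom m := by
  change (algebraMap k (A : Type u)ᵐᵒᵖ c) • f.hom.hom m = _
  rw [Algebra.algebraMap_eq_smul_one]
  rfl

theorem sum_hom_apply {M N : A.Mod} {ι : Type*} (s : Finset ι) (f : ι → (M ⟶ N)) (m : M.obj) :
    (∑ i ∈ s, f i).hom.hom m = ∑ i ∈ s, (f i).hom.hom m :=
  map_sum (AddMonoidHom.mk' (fun f : M ⟶ N => f.hom.hom m) (fun _ _ => rfl)) f s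

theorem op_mul_smul {M : A.Mod} (a b : A) (m : M.obj) : op (a * b) • m = op b • op a • m := by
  rw [op_mul, mul_smul]

end Mod

section Skew

variable {k G : Type u} [Field k] [Group G] [Finite G] (A : GAlgebra k G)

/-- The inclusion of `A` in the skew-group algebra. -/
noncomputable def inc : A →ₐ[k] A.skew :=
  AlgHom.ofLinearMap
    { toFun := fun a => (SkewMonoidAlgebra.single 1 a : A.SkewGroupRing)
      map_add' := fun a b => SkewMonoidAlgebra.single_add 1 a b
      map_smul' := fun c a => (SkewMonoidAlgebra.smul_single c 1 a).symm }
    rfl (fun a b => by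
      refine ((A.skewGroupRing_mul 1 1 a b).trans ?_).symm
      rw [map_one, one_mul, AlgEquiv.one_apply]
      rfl)

/-- The inclusion of the group in the skew-group algebra. -/
noncomputable def grp : G →* A.skew where
  toFun g := (SkewMonoidAlgebra.single g 1 : A.SkewGroupRing)
  map_one' := rfl
  map_mul' g h := by
    refine ((A.skewGroupRing_mul g h 1 1).trans ?_).symm
    rw [map_one, one_mul]

theorem inc_mul_grp (a : A) (g : G) : A.inc a * A.grp g =
    (SkewMonoidAlgebra.single g a : A.SkewGroupRing) := by
  refine (A.skewGroupRing_mul 1 g a 1).trans ?_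
  rw [map_one, one_mul, mul_one]

theorem grp_mul_inc (g : G) (a : A) : A.grp g * A.inc a = A.inc (A.ρ g a) * A.grp g := by
  rw [inc_mul_grp]
  refine (A.skewGroupRing_mul g 1 1 a).trans ?_
  rw [mul_one, one_mul]

theorem inc_mul_grp' (g : G) (a : A) : A.inc a * A.grp g = A.grp g * A.inc (A.ρ g⁻¹ a) := by
  rw [grp_mul_inc, ← AlgEquiv.mul_apply, ← map_mul, mul_inv_cancel, map_one, AlgEquiv.one_apply]

theorem skew_ρ_inc (χ : G →* kˣ) (a : A) : A.skew.ρ χ (A.inc a) = A.inc a := by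
  refine (A.skew_ρ_single χ 1 a).trans ?_
  rw [map_one, Units.val_one, one_smul]
  rfl

theorem skew_ρ_grp (χ : G →* kˣ) (g : G) :
    A.skew.ρ χ (A.grp g) = ((χ g : kˣ) : k) • A.grp g := by
  refine (A.skew_ρ_single χ g 1).trans ?_
  rw [← SkewMonoidAlgebra.smul_single]
  rfl

theorem skew_induction {p : A.skew → Prop} (x : A.skew) (h : ∀ a g, p (A.inc a * A.grp g))
    (hadd : ∀ x y, p x → p y → p (x + y)) : p x := by
  refine SkewMonoidAlgebra.induction_on' (k := A) (G := G) (p := p) x (fun g a => ?_) hadd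
  rw [← inc_mul_grp]
  exact h a g

/-- A map between modules over the skew-group algebra is linear if it commutes with the actions
of the algebra and of the group. -/
def skewLinear {V W : Type*} [AddCommGroup V] [AddCommGroup W] [Module (A.skew : Type u)ᵐᵒᵖ V]
    [Module (A.skew : Type u)ᵐᵒᵖ W] (f : V → W) (hadd : ∀ v w, f (v + w) = f v + f w)
    (hA : ∀ a v, f (op (A.inc a) • v) = op (A.inc a) • f v)
    (hG : ∀ g v, f (op (A.grp g) • v) = op (A.grp g) • f v) : V →ₗ[(A.skew : Type u)ᵐᵒᵖ] W where
  toFun := f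
  map_add' := hadd
  map_smul' r v := by
    obtain ⟨r, rfl⟩ := op_surjective r
    induction r using A.skew_induction with
    | h a g => rw [RingHom.id_apply, op_mul, mul_smul, mul_smul, hG, hA]
    | hadd x y hx hy =>
      rw [RingHom.id_apply] at hx hy ⊢
      rw [MulOpposite.op_add, add_smul, add_smul, hadd, hx, hy]

/-- The restriction of a module over the skew-group algebra is finitely generated. -/
theorem res_isFG (Y : A.skew.Mod) : ModuleCat.isFG _
    ((ModuleCat.restrictScalars (RingHom.op (A.inc : (A : Type u) →+* A.skew))).obj Y.obj) := by
  have hY : Module.Finite (A.skew : Type u)ᵐᵒᵖ Y.obj := Y.property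
  obtain ⟨S, hS⟩ := hY
  let V := (ModuleCat.restrictScalars (RingHom.op (A.inc : (A : Type u) →+* A.skew))).obj Y.obj
  have : Module.Finite (A : Type u)ᵐᵒᵖ V := by
    let act : G → V → V := fun g y => (show Y.obj from op (A.grp g) • (show Y.obj from y))
    have act_smul : ∀ (g : G) (a : (A : Type u)ᵐᵒᵖ) (y : V),
        act g (a • y) = (op (A.ρ g⁻¹ a.unop)) • act g y := fun g a y => by
      change op (A.grp g) • op (A.inc a.unop) • (show Y.obj from y) =
        op (A.inc (A.ρ g⁻¹ a.unop)) • op (A.grp g) • (show Y.obj from y)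
      rw [← mul_smul, ← mul_smul, ← op_mul, ← op_mul, inc_mul_grp']
    have act_add : ∀ (g : G) (y z : V), act g (y + z) = act g y + act g z := fun g y z =>
      smul_add _ (show Y.obj from y) (show Y.obj from z)
    have act_zero : ∀ (g : G), act g 0 = 0 := fun g => smul_zero (A := Y.obj) _
    -- The finitely many translates by the group of generators over the skew-group algebra generate
    -- over `A`: their span is stable under the group because the group acts semilinearly.
    let T : Set V := Set.image2 act Set.univ (S : Set Y.obj)
    have hT : T.Finite := Set.Finite.image2 _ Set.finite_univ S.finite_toSet
    have key : ∀ (g : G) (y : V), y ∈ Submodule.span (A : Type u)ᵐᵒᵖ T →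
        act g y ∈ Submodule.span (A : Type u)ᵐᵒᵖ T := by
      intro g y hy
      induction hy using Submodule.span_induction with
      | mem y hy =>
        obtain ⟨h, -, s, hs, rfl⟩ := hy
        refine Submodule.subset_span ⟨h * g, trivial, s, hs, ?_⟩
        change op (A.grp (h * g)) • s = op (A.grp g) • op (A.grp h) • s
        rw [map_mul, op_mul, mul_smul]
      | zero => rw [act_zero]; exact zero_mem _
      | add x y _ _ hx hy => rw [act_add]; exact add_mem hx hy
      | smul a x _ hx => rw [act_smul]; exact Submodule.smul_mem _ _ hx
    have key2 : ∀ (r : A.skew) (y : V), y ∈ Submodule.span (A : Type u)ᵐᵒᵖ T →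
        (show V from (show Y.obj from op r • (show Y.obj from y))) ∈
          Submodule.span (A : Type u)ᵐᵒᵖ T := by
      intro r y hy
      induction r using A.skew_induction with
      | h a g =>
        have := key g _ (Submodule.smul_mem _ (op a) hy)
        rw [op_mul, mul_smul]
        exact this
      | hadd x z hx hz =>
        have := add_mem hx hz
        have e : op (x + z) • (show Y.obj from y) = op x • (show Y.obj from y) +
          op z • (show Y.obj from y) := by rw [MulOpposite.op_add, add_smul]
        exact e ▸ this
    refine ⟨⟨hT.toFinset, ?_⟩⟩
    rw [Set.Finite.coe_toFinset, eq_top_iff]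
    suffices ∀ y : Y.obj, (show V from y) ∈ Submodule.span (A : Type u)ᵐᵒᵖ T from
      fun y _ => this y
    intro y
    have hy : y ∈ Submodule.span (A.skew : Type u)ᵐᵒᵖ (S : Set Y.obj) := by
      rw [hS]; trivial
    induction hy using Submodule.span_induction with
    | mem y hy =>
      refine Submodule.subset_span ⟨1, trivial, y, hy, ?_⟩
      change op (A.grp 1) • y = y
      rw [map_one, op_one, one_smul]
    | zero => exact zero_mem _
    | add x y _ _ hx hy => exact add_mem hx hy
    | smul a x _ hx => exact key2 a.unop x hx
  exact this

/-- The restriction of modules from the skew-group algebra to `A`. -/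
noncomputable def res : A.skew.Mod ⥤ A.Mod :=
  (ModuleCat.isFG _).lift ((ModuleCat.isFG _).ι ⋙
    ModuleCat.restrictScalars (RingHom.op (A.inc : (A : Type u) →+* A.skew))) A.res_isFG

/-- The module over the skew-group algebra induced by `M`: the function `w` stands for
`∑ w x ⊗ x`. -/
def Ind (M : A.Mod) : Type u := G → M.obj

noncomputable instance (M : A.Mod) : AddCommGroup (A.Ind M) := inferInstanceAs (AddCommGroup (G → M.obj))

/-- The action of `A` on the induced module. -/
noncomputable def indAlg (M : A.Mod) : (A : Type u) →+* (AddMonoid.End (G → M.obj))ᵐᵒᵖ where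
  toFun a := op (AddMonoidHom.mk' (fun w x => op (A.ρ x a) • w x)
    (fun v w => funext fun x => smul_add _ _ _))
  map_one' := congrArg op (AddMonoidHom.ext fun w => funext fun x => by
    change op (A.ρ x 1) • w x = w x
    rw [map_one, op_one, one_smul])
  map_mul' a b := congrArg op (AddMonoidHom.ext fun w => funext fun x => by
    change op (A.ρ x (a * b)) • w x = op (A.ρ x b) • op (A.ρ x a) • w x
    rw [map_mul, op_mul, mul_smul])
  map_zero' := congrArg op (AddMonoidHom.ext fun w => funext fun x => by
    change op (A.ρ x 0) • w x = 0
    rw [map_zero, op_zero, zero_smul])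
  map_add' a b := congrArg op (AddMonoidHom.ext fun w => funext fun x => by
    change op (A.ρ x (a + b)) • w x = op (A.ρ x a) • w x + op (A.ρ x b) • w x
    rw [map_add, MulOpposite.op_add, add_smul])

/-- The action of the group on the induced module. -/
noncomputable def indGrp (M : A.Mod) : G →* (AddMonoid.End (G → M.obj))ᵐᵒᵖ where
  toFun g := op (AddMonoidHom.mk' (fun w x => w (x * g⁻¹)) (fun v w => rfl))
  map_one' := congrArg op (AddMonoidHom.ext fun w => funext fun x => by
    change w (x * 1⁻¹) = w x
    rw [inv_one, mul_one])
  map_mul' g h := congrArg op (AddMonoidHom.ext fun w => funext fun x => by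
    change w (x * (g * h)⁻¹) = w (x * h⁻¹ * g⁻¹)
    rw [mul_inv_rev, mul_assoc])

/-- The action of the skew-group algebra on the induced module, as a ring homomorphism. -/
noncomputable def indHom (M : A.Mod) : (A.skew : Type u) →+* (AddMonoid.End (G → M.obj))ᵐᵒᵖ :=
  SkewMonoidAlgebra.liftNCRingHom (A.indAlg M) (A.indGrp M) (fun {a g} =>
    congrArg op (AddMonoidHom.ext fun w => funext fun x => by
      change op (A.ρ (x * g⁻¹) (A.ρ g a)) • w (x * g⁻¹) = op (A.ρ x a) • w (x * g⁻¹)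
      rw [← AlgEquiv.mul_apply, ← map_mul, inv_mul_cancel_right]))

noncomputable instance (M : A.Mod) : Module (A.skew : Type u)ᵐᵒᵖ (A.Ind M) :=
  Module.compHom (G → M.obj) ((RingEquiv.opOp (AddMonoid.End (G → M.obj))).symm.toRingHom.comp
    (A.indHom M).op)

/-- From (m ⊗ x) a = m x(a) ⊗ x. -/
theorem ind_inc_smul (M : A.Mod) (a : A) (w : A.Ind M) (x : G) :
    (op (A.inc a) • w : A.Ind M) x = op (A.ρ x a) • w x := by
  have h : A.indHom M (A.inc a) = A.indAlg M a := by
    refine (SkewMonoidAlgebra.liftNC_single _ _ _ _).trans ?_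
    exact (congrArg _ (map_one (A.indGrp M))).trans (mul_one _)
  change (A.indHom M (A.inc a)).unop w x = _
  rw [h]
  rfl

/-- From (m ⊗ x) g = m ⊗ xg, so the component at `x` comes from `x * g⁻¹`. -/
theorem ind_grp_smul (M : A.Mod) (g : G) (w : A.Ind M) (x : G) :
    (op (A.grp g) • w : A.Ind M) x = w (x * g⁻¹) := by
  have h : A.indHom M (A.grp g) = A.indGrp M g := by
    refine (SkewMonoidAlgebra.liftNC_single _ _ _ _).trans ?_
    exact (congrArg (· * _) (map_one (A.indAlg M))).trans (one_mul _)
  change (A.indHom M (A.grp g)).unop w x = _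
  rw [h]
  rfl

end Skew
end GAlgebra

namespace GAlgebra

open MulOpposite

section Scalars

variable {k G : Type u} [Field k] [Group G] {A : GAlgebra k G}

theorem ρ_mul_apply (g h : G) (a : A) : A.ρ (g * h) a = A.ρ g (A.ρ h a) := by
  rw [map_mul, AlgEquiv.mul_apply]

theorem ρ_inv_apply (g : G) (a : A) : A.ρ g⁻¹ (A.ρ g a) = a := by
  rw [← ρ_mul_apply, inv_mul_cancel, map_one, AlgEquiv.one_apply]

/-- The scalar multiplication on a right module. -/
def sc {M : A.Mod} (c : k) (m : M.obj) : M.obj := op (c • (1 : A)) • m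

variable {M N : A.Mod}

theorem sc_add (c : k) (m n : M.obj) : sc c (m + n) = sc c m + sc c n := smul_add _ _ _

theorem sc_sum (c : k) {ι : Type*} (s : Finset ι) (m : ι → M.obj) :
    sc c (∑ i ∈ s, m i) = ∑ i ∈ s, sc c (m i) := Finset.smul_sum

theorem add_sc (c d : k) (m : M.obj) : sc (c + d) m = sc c m + sc d m := by
  rw [sc, add_smul, MulOpposite.op_add, add_smul]
  rfl

theorem zero_sc (m : M.obj) : sc (0 : k) m = 0 := by
  rw [sc, zero_smul, op_zero, zero_smul]

theorem sum_sc {ι : Type*} (s : Finset ι) (c : ι → k) (m : M.obj) :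
    sc (∑ i ∈ s, c i) m = ∑ i ∈ s, sc (c i) m :=
  map_sum (AddMonoidHom.mk' (fun c => sc c m) (fun c d => add_sc c d m)) c s

theorem sc_sc (c d : k) (m : M.obj) : sc c (sc d m) = sc (c * d) m := by
  rw [sc, sc, sc, ← mul_smul, ← op_mul, smul_one_mul, smul_smul, mul_comm]

theorem one_sc (m : M.obj) : sc (1 : k) m = m := by
  rw [sc, one_smul, op_one, one_smul]

theorem op_smul_smul (c : k) (a : A) (m : M.obj) : op (c • a) • m = sc c (op a • m) := by
  rw [sc, ← mul_smul, ← op_mul, mul_smul_one]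

theorem op_smul_sc (c : k) (a : A) (m : M.obj) : op a • sc c m = sc c (op a • m) := by
  rw [sc, sc, ← mul_smul, ← mul_smul, ← op_mul, ← op_mul, smul_one_mul, mul_smul_one]

theorem hom_sc (f : M ⟶ N) (c : k) (m : M.obj) : f.hom.hom (sc c m) = sc c (f.hom.hom m) :=
  map_smul f.hom.hom _ _

theorem smul_hom_apply' (c : k) (f : M ⟶ N) (m : M.obj) :
    (c • f).hom.hom m = sc c (f.hom.hom m) := smul_hom_apply c f m

/-- The isomorphism of `mod A` given by a linear equivalence. -/
def mkIso (e : M.obj ≃ₗ[(A : Type u)ᵐᵒᵖ] N.obj) : M ≅ N where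
  hom := mkHom e.toLinearMap
  inv := mkHom e.symm.toLinearMap
  hom_inv_id := mod_hom_ext e.symm_apply_apply
  inv_hom_id := mod_hom_ext e.apply_symm_apply

end Scalars

section Skew

variable {k G : Type u} [Field k] [Group G] [Fintype G] (A : GAlgebra k G)

/-- Scalars act through the algebra, and `inc` and the automorphisms `ρ g` are `k`-linear. For that
reason induction, restriction and twists all respect them. -/
theorem sc_ind (M : A.Mod) (c : k) (w : A.Ind M) (x : G) :
    (op (c • (1 : A.skew)) • w : A.Ind M) x = sc c (w x) := by
  have h : c • (1 : A.skew) = A.inc (c • 1) := by rw [map_smul, map_one]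
  rw [h, ind_inc_smul, map_smul, map_one]
  rfl

theorem sc_res (Y : A.skew.Mod) (c : k) (y : Y.obj) :
    sc (M := A.res.obj Y) c y = sc (M := Y) c y := by
  change op (A.inc (c • 1)) • y = op (c • 1) • y
  rw [map_smul, map_one]

omit [Fintype G] in
theorem sc_twist (M : A.Mod) (g : G) (c : k) (m : M.obj) :
    sc (M := (A.twist g).obj M) c m = sc (M := M) c m := by
  change op (A.ρ g (c • 1)) • m = op (c • 1) • m
  rw [map_smul, map_one]

/-- The embedding of a module in the induced module. -/
noncomputable def indSingle (M : A.Mod) (m : M.obj) : A.Ind M :=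
  open scoped Classical in (Pi.single 1 m : G → M.obj)

omit [Fintype G] in
theorem indSingle_one (M : A.Mod) (m : M.obj) : A.indSingle M m 1 = m := by
  classical
  simp [indSingle]

omit [Fintype G] in
theorem indSingle_ne (M : A.Mod) (m : M.obj) {x : G} (hx : x ≠ 1) : A.indSingle M m x = 0 := by
  classical
  simp [indSingle, hx]

omit [Fintype G] in
theorem indSingle_add (M : A.Mod) (m n : M.obj) :
    A.indSingle M (m + n) = A.indSingle M m + A.indSingle M n := by
  classical
  exact Pi.single_add _ _ _

theorem indSingle_smul (M : A.Mod) (a : A) (m : M.obj) :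
    A.indSingle M (op a • m) = op (A.inc a) • A.indSingle M m := by
  funext x
  rw [ind_inc_smul]
  by_cases hx : x = 1
  · subst hx
    rw [indSingle_one, indSingle_one, map_one, AlgEquiv.one_apply]
  · rw [indSingle_ne _ _ _ hx, indSingle_ne _ _ _ hx, smul_zero]

/-- Writes ∑ w(x) ⊗ x as ∑ (w(x) ⊗ 1) x. It is a triangle identity, and it shows that the elements m
⊗ 1 generate. -/
theorem sum_indSingle (M : A.Mod) (w : A.Ind M) :
    ∑ x, op (A.grp x) • A.indSingle M (w x) = w := by
  funext y
  have e : (∑ x, op (A.grp x) • A.indSingle M (w x)) y =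
      ∑ x, (op (A.grp x) • A.indSingle M (w x)) y :=
    map_sum (Pi.evalAddMonoidHom (fun _ : G => M.obj) y) _ _
  rw [e, Finset.sum_eq_single y]
  · rw [ind_grp_smul, mul_inv_cancel, indSingle_one]
  · intro x _ hx
    rw [ind_grp_smul, indSingle_ne]
    exact fun h => hx (mul_inv_eq_one.1 h).symm
  · simp

/-- The element of the induced module given by a function. -/
def indMk {M : A.Mod} (w : G → M.obj) : A.Ind M := w

omit [Fintype G] in
theorem indMk_apply {M : A.Mod} (w : G → M.obj) (x : G) : A.indMk w x = w x := rfl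

instance ind_finite (M : A.Mod) : Module.Finite (A.skew : Type u)ᵐᵒᵖ (A.Ind M) := by
  have hM : Module.Finite (A : Type u)ᵐᵒᵖ M.obj := M.property
  classical
  obtain ⟨S, hS⟩ := hM
  refine ⟨⟨S.image (A.indSingle M), ?_⟩⟩
  suffices ∀ m : M.obj, A.indSingle M m ∈
      Submodule.span (A.skew : Type u)ᵐᵒᵖ (S.image (A.indSingle M) : Set (A.Ind M)) by
    rw [eq_top_iff]
    rintro w -
    rw [← A.sum_indSingle M w]
    exact sum_mem fun x _ => Submodule.smul_mem _ _ (this _)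
  intro m
  have hm : m ∈ Submodule.span (A : Type u)ᵐᵒᵖ (S : Set M.obj) := by
    rw [hS]; trivial
  induction hm using Submodule.span_induction with
  | mem m hm =>
    exact Submodule.subset_span (Finset.mem_coe.2 (Finset.mem_image_of_mem _ hm))
  | zero =>
    have : A.indSingle M 0 = 0 := Pi.single_zero _
    rw [this]
    exact zero_mem _
  | add m n _ _ hm hn => rw [indSingle_add]; exact add_mem hm hn
  | smul a m _ hm =>
    obtain ⟨a, rfl⟩ := op_surjective a
    rw [indSingle_smul]
    exact Submodule.smul_mem _ _ hm

/-- The induction of modules from `A` to the skew-group algebra. -/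
noncomputable def ind : A.Mod ⥤ A.skew.Mod where
  obj M := FGModuleCat.of _ (A.Ind M)
  map {M N} f := FGModuleCat.ofHom (A.skewLinear (V := A.Ind M) (W := A.Ind N)
    (fun w => A.indMk fun x => f.hom.hom (w x))
    (fun v w => funext fun x => map_add f.hom.hom _ _)
    (fun a v => funext fun x => by
      rw [ind_inc_smul, indMk_apply, ind_inc_smul, map_smul, indMk_apply])
    (fun g v => funext fun x => by
      rw [ind_grp_smul, indMk_apply, ind_grp_smul, indMk_apply]))
  map_id M := mod_hom_ext fun m => rfl
  map_comp f g := mod_hom_ext fun m => rfl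

theorem sc_ind_obj (M : A.Mod) (c : k) (w : (A.ind.obj M).obj) (x : G) :
    (sc c w : A.Ind M) x = sc c ((w : A.Ind M) x) := A.sc_ind M c w x

instance : A.ind.Additive where
  map_add := mod_hom_ext fun _ => rfl

instance : A.ind.Linear k where
  map_smul {M N} f c := mod_hom_ext fun w => by
    refine Eq.trans (funext fun x => ?_) (smul_hom_apply' c (A.ind.map f) w).symm
    exact (smul_hom_apply' c f ((w : A.Ind M) x)).trans (A.sc_ind_obj N c ((A.ind.map f).hom.hom w) x).symm

instance : A.res.Additive where
  map_add := mod_hom_ext fun _ => rfl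

instance : A.res.Linear k where
  map_smul {M N} f c := mod_hom_ext fun m => by
    refine Eq.trans ?_ (smul_hom_apply' c (A.res.map f) m).symm
    exact (smul_hom_apply' c f m).trans (A.sc_res N c (f.hom.hom m)).symm

/-- The unit of the adjunction between induction and restriction. -/
noncomputable def indUnit : 𝟭 A.Mod ⟶ A.ind ⋙ A.res where
  app M := mkHom (N := A.res.obj (A.ind.obj M))
    { toFun := A.indSingle M
      map_add' := A.indSingle_add M
      map_smul' := fun a m => A.indSingle_smul M a.unop m }
  naturality M N f := mod_hom_ext fun m => funext fun x => by
    change A.indSingle N (f.hom.hom m) x = f.hom.hom (A.indSingle M m x)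
    by_cases hx : x = 1
    · subst hx
      rw [indSingle_one, indSingle_one]
    · rw [indSingle_ne _ _ _ hx, indSingle_ne _ _ _ hx, map_zero]

/-- The underlying map of the counit of the adjunction between induction and restriction. -/
noncomputable def indCounitFun (Y : A.skew.Mod) (w : A.Ind (A.res.obj Y)) : Y.obj :=
  ∑ x, op (A.grp x) • (show Y.obj from w x)

/-- The counit of the adjunction between induction and restriction. -/
noncomputable def indCounit : A.res ⋙ A.ind ⟶ 𝟭 A.skew.Mod where
  app Y := mkHom (M := A.ind.obj (A.res.obj Y)) (N := Y)
    (A.skewLinear (V := A.Ind (A.res.obj Y)) (W := Y.obj) (A.indCounitFun Y)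
      (fun v w => by
        rw [indCounitFun, indCounitFun, indCounitFun, ← Finset.sum_add_distrib]
        exact Finset.sum_congr rfl fun x _ => smul_add (A := Y.obj) _ _ _)
      (fun a v => by
        rw [indCounitFun, indCounitFun, Finset.smul_sum]
        refine Finset.sum_congr rfl fun x _ => ?_
        rw [ind_inc_smul]
        change op (A.grp x) • op (A.inc (A.ρ x a)) • (show Y.obj from v x) = _
        rw [← op_mul_smul, ← op_mul_smul, grp_mul_inc])
      (fun g v => by
        rw [indCounitFun, indCounitFun, Finset.smul_sum,
          ← Equiv.sum_comp (Equiv.mulRight g)]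
        refine Finset.sum_congr rfl fun x _ => ?_
        rw [ind_grp_smul, Equiv.coe_mulRight, mul_inv_cancel_right, map_mul, op_mul_smul]))
  naturality Y Z f := mod_hom_ext fun w => by
    change ∑ x, op (A.grp x) • f.hom.hom _ = f.hom.hom (∑ x, op (A.grp x) • _)
    rw [map_sum]
    exact Finset.sum_congr rfl fun x _ => (map_smul _ _ _).symm

/-- The underlying map of the unit of the adjunction between restriction and induction. -/
noncomputable def resUnitFun (Y : A.skew.Mod) (y : Y.obj) : A.Ind (A.res.obj Y) :=
  A.indMk (M := A.res.obj Y) fun x => (show Y.obj from op (A.grp x⁻¹) • y)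

theorem resUnitFun_apply (Y : A.skew.Mod) (y : Y.obj) (x : G) :
    A.resUnitFun Y y x = op (A.grp x⁻¹) • y := rfl

/-- The unit of the adjunction between restriction and induction. -/
noncomputable def resUnit : 𝟭 A.skew.Mod ⟶ A.res ⋙ A.ind where
  app Y := mkHom (M := Y) (N := A.ind.obj (A.res.obj Y))
    (A.skewLinear (V := Y.obj) (W := A.Ind (A.res.obj Y)) (A.resUnitFun Y)
      (fun v w => funext fun x => smul_add (A := Y.obj) _ _ _)
      (fun a v => funext fun x => by
        rw [ind_inc_smul, resUnitFun_apply, resUnitFun_apply]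
        change op (A.grp x⁻¹) • op (A.inc a) • v = op (A.inc (A.ρ x a)) • op (A.grp x⁻¹) • v
        rw [← op_mul_smul, ← op_mul_smul, inc_mul_grp', inv_inv])
      (fun g v => funext fun x => by
        rw [ind_grp_smul, resUnitFun_apply, resUnitFun_apply, ← op_mul_smul, ← map_mul,
          mul_inv_rev, inv_inv]))
  naturality Y Z f := mod_hom_ext fun y => funext fun x =>
    (map_smul f.hom.hom (op (A.grp x⁻¹)) y).symm

/-- The counit of the adjunction between restriction and induction. -/
noncomputable def resCounit : A.ind ⋙ A.res ⟶ 𝟭 A.Mod where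
  app M := mkHom (M := A.res.obj (A.ind.obj M))
    { toFun := fun w => (show A.Ind M from w) 1
      map_add' := fun _ _ => rfl
      map_smul' := fun a w => by
        refine (A.ind_inc_smul M a.unop w 1).trans ?_
        rw [map_one]
        rfl }
  naturality M N f := mod_hom_ext fun w => rfl

/-- The projections of the restriction of an induced module to the twists. -/
noncomputable def indProj (g : G) : A.ind ⋙ A.res ⟶ A.twist g where
  app M := mkHom (M := A.res.obj (A.ind.obj M)) (N := (A.twist g).obj M)
    { toFun := fun w => (show A.Ind M from w) g
      map_add' := fun _ _ => rfl
      map_smul' := fun a w => A.ind_inc_smul M a.unop w g }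
  naturality M N f := mod_hom_ext fun w => rfl

/-- The underlying map of `indTwist`. -/
def indTwistFun (g : G) (M : A.Mod) (w : A.Ind ((A.twist g).obj M)) : A.Ind M :=
  A.indMk fun y => (show M.obj from w (g⁻¹ * y))

omit [Fintype G] in
theorem indTwistFun_apply (g : G) (M : A.Mod) (w : A.Ind ((A.twist g).obj M)) (y : G) :
    A.indTwistFun g M w y = w (g⁻¹ * y) := rfl

/-- Modules that are twists of each other induce isomorphic modules. -/
noncomputable def indTwist (g : G) : A.twist g ⋙ A.ind ≅ A.ind :=
  NatIso.ofComponents (fun M => mkIso (M := A.ind.obj ((A.twist g).obj M)) (N := A.ind.obj M)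
    { A.skewLinear (V := A.Ind ((A.twist g).obj M)) (W := A.Ind M) (A.indTwistFun g M)
        (fun v w => rfl)
        (fun a v => funext fun y => by
          rw [ind_inc_smul, indTwistFun_apply, indTwistFun_apply, ind_inc_smul]
          -- The map is m ⊗ x ↦ m ⊗ gx; the extra `ρ g` of the twist is what the translation from
          -- `g⁻¹ * y` to `y` requires.
          change op (A.ρ g (A.ρ (g⁻¹ * y) a)) • (show M.obj from v (g⁻¹ * y)) = _
          rw [← ρ_mul_apply, mul_inv_cancel_left])
        (fun h v => funext fun y => by
          rw [ind_grp_smul, indTwistFun_apply, indTwistFun_apply, ind_grp_smul, mul_assoc]) with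
      invFun := fun w => A.indMk (M := (A.twist g).obj M) fun y => (show A.Ind M from w) (g * y)
      left_inv := fun w => funext fun y => congrArg w (inv_mul_cancel_left g y)
      right_inv := fun w => funext fun y => congrArg w (mul_inv_cancel_left g y) })
    (fun _ => mod_hom_ext fun _ => rfl)

/-- The multiplication of the components of an element of an induced module by the values of a
character. -/
def indChar (χ : G →* kˣ) (M : A.Mod) (w : A.Ind M) : A.Ind M :=
  A.indMk fun x => sc ((χ x : kˣ) : k) (w x)

omit [Fintype G] in
theorem indChar_apply (χ : G →* kˣ) (M : A.Mod) (w : A.Ind M) (x : G) :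
    A.indChar χ M w x = sc ((χ x : kˣ) : k) (w x) := rfl

omit [Fintype G] in
theorem indChar_add (χ : G →* kˣ) (M : A.Mod) (v w : A.Ind M) :
    A.indChar χ M (v + w) = A.indChar χ M v + A.indChar χ M w :=
  funext fun _ => sc_add _ _ _

omit [Fintype G] in
theorem indChar_mul (χ ψ : G →* kˣ) (M : A.Mod) (w : A.Ind M) :
    A.indChar (χ * ψ) M w = A.indChar χ M (A.indChar ψ M w) :=
  funext fun x => by
    rw [indChar_apply, indChar_apply, indChar_apply, sc_sc, MonoidHom.mul_apply, Units.val_mul]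

omit [Fintype G] in
theorem indChar_one (M : A.Mod) (w : A.Ind M) : A.indChar 1 M w = w :=
  funext fun x => by
    rw [indChar_apply, MonoidHom.one_apply, Units.val_one, one_sc]

theorem indChar_inv (χ : G →* kˣ) (M : A.Mod) (w : A.Ind M) :
    A.indChar χ⁻¹ M (A.indChar χ M w) = w :=
  (A.indChar_mul _ _ M w).symm.trans
    ((congrArg (A.indChar · M w) (inv_mul_cancel χ)).trans (A.indChar_one M w))

theorem indChar_inv' (χ : G →* kˣ) (M : A.Mod) (w : A.Ind M) :
    A.indChar χ M (A.indChar χ⁻¹ M w) = w :=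
  (A.indChar_mul _ _ M w).symm.trans
    ((congrArg (A.indChar · M w) (mul_inv_cancel χ)).trans (A.indChar_one M w))

/-- It suffices to treat products of elements of `A` and of the group. The former are fixed by `χ`;
for the latter the factor χ(g) is absorbed by the shift, as χ⁻¹(x) χ(g) = χ⁻¹(x g⁻¹). -/
theorem indChar_smul (χ : G →* kˣ) (M : A.Mod) (r : A.skew) (w : A.Ind M) :
    A.indChar χ⁻¹ M (op (A.skew.ρ χ r) • w) = op r • A.indChar χ⁻¹ M w := by
  induction r using A.skew_induction generalizing w with
  | h a g =>
    rw [map_mul, op_mul, mul_smul, skew_ρ_inc, skew_ρ_grp, op_mul, mul_smul]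
    have h (v : A.Ind M) : op (((χ g : kˣ) : k) • A.grp g) • v =
        op (((χ g : kˣ) : k) • 1 : A.skew) • op (A.grp g) • v := by
      rw [← mul_smul, ← op_mul, mul_smul_one]
    rw [h]
    funext x
    rw [indChar_apply, sc_ind, ind_grp_smul, ind_inc_smul, ind_grp_smul]
    refine Eq.trans ?_ (A.ind_inc_smul M a (A.indChar χ⁻¹ M w) (x * g⁻¹)).symm
    rw [indChar_apply, op_smul_sc, sc_sc]
    congr 1
    rw [MonoidHom.inv_apply, MonoidHom.inv_apply, ← Units.val_mul]
    simp [mul_comm]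
  | hadd r s hr hs =>
    rw [map_add, MulOpposite.op_add, MulOpposite.op_add, add_smul, add_smul, indChar_add, hr, hs]

/-- Induced modules are invariant under the twists by characters. -/
noncomputable def twistInd (χ : G →* kˣ) : A.ind ⋙ A.skew.twist χ ≅ A.ind :=
  NatIso.ofComponents (fun M => mkIso (M := (A.skew.twist χ).obj (A.ind.obj M))
    (N := A.ind.obj M)
    { toFun := A.indChar χ⁻¹ M
      map_add' := A.indChar_add χ⁻¹ M
      map_smul' := fun r w => A.indChar_smul χ M r.unop w
      invFun := A.indChar χ M
      left_inv := fun w => A.indChar_inv' χ M w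
      right_inv := fun w => A.indChar_inv χ M w })
    (fun f => mod_hom_ext fun w => funext fun x => (hom_sc f _ _).symm)

/-- The underlying map of `charProj`. -/
noncomputable def charProjFun (χ : G →* kˣ) (Y : A.skew.Mod) (w : A.Ind (A.res.obj Y)) : Y.obj :=
  A.indCounitFun Y (A.indChar χ (A.res.obj Y) w)

theorem charProjFun_smul (χ : G →* kˣ) (Y : A.skew.Mod) (r : A.skew)
    (w : A.Ind (A.res.obj Y)) :
    A.charProjFun χ Y (op r • w) = op (A.skew.ρ χ r) • A.charProjFun χ Y w := by
  have h := A.indChar_smul χ⁻¹ (A.res.obj Y) (A.skew.ρ χ r) w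
  rw [ρ_inv_apply, show χ⁻¹⁻¹ = χ from inv_inv χ] at h
  rw [charProjFun, h]
  exact map_smul (A.indCounit.app Y).hom.hom (op (A.skew.ρ χ r)) _

/-- The projections of the modules induced by restrictions to the twists by characters, up to
normalization. -/
noncomputable def charProj (χ : G →* kˣ) : A.res ⋙ A.ind ⟶ A.skew.twist χ where
  app Y := mkHom (M := A.ind.obj (A.res.obj Y)) (N := (A.skew.twist χ).obj Y)
    { toFun := A.charProjFun χ Y
      map_add' := fun v w => by
        refine (congrArg _ (A.indChar_add χ _ v w)).trans ?_
        exact map_add (A.indCounit.app Y).hom.hom _ _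
      map_smul' := fun r w => A.charProjFun_smul χ Y r.unop w }
  naturality Y Z f := mod_hom_ext fun w => by
    refine Eq.trans ?_ (congr($(A.indCounit.naturality f).hom.hom (A.indChar χ (A.res.obj Y) w)))
    refine congrArg (A.indCounitFun Z) (funext fun x => ?_)
    exact (hom_sc (A.res.map f) _ _).symm

/-- The underlying map of `resTwist`. -/
def resTwistFun (χ : G →* kˣ) (Y : A.skew.Mod) (y : (A.res.obj ((A.skew.twist χ).obj Y)).obj) :
    (A.res.obj Y).obj :=
  let z : ((A.skew.twist χ).obj Y).obj := y
  let z' : Y.obj := z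
  z'

/-- The underlying map of the inverse of `resTwist`. -/
def resTwistInv (χ : G →* kˣ) (Y : A.skew.Mod) (y : (A.res.obj Y).obj) :
    (A.res.obj ((A.skew.twist χ).obj Y)).obj :=
  let z : Y.obj := y
  let z' : ((A.skew.twist χ).obj Y).obj := z
  z'

theorem resTwistFun_add (χ : G →* kˣ) (Y : A.skew.Mod)
    (y z : (A.res.obj ((A.skew.twist χ).obj Y)).obj) :
    A.resTwistFun χ Y (y + z) = A.resTwistFun χ Y y + A.resTwistFun χ Y z := rfl

theorem resTwistFun_smul (χ : G →* kˣ) (Y : A.skew.Mod) (a : A)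
    (y : (A.res.obj ((A.skew.twist χ).obj Y)).obj) :
    A.resTwistFun χ Y (op a • y) = op a • A.resTwistFun χ Y y := by
  change op (A.skew.ρ χ (A.inc a)) • (show Y.obj from A.resTwistFun χ Y y) =
    op (A.inc a) • (show Y.obj from A.resTwistFun χ Y y)
  rw [skew_ρ_inc]

/-- The twists by characters do not change the restriction. -/
noncomputable def resTwist (χ : G →* kˣ) : A.skew.twist χ ⋙ A.res ≅ A.res :=
  NatIso.ofComponents (fun Y => mkIso (M := A.res.obj ((A.skew.twist χ).obj Y))
    (N := A.res.obj Y)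
    { toFun := A.resTwistFun χ Y
      map_add' := A.resTwistFun_add χ Y
      map_smul' := fun a y => A.resTwistFun_smul χ Y a.unop y
      invFun := A.resTwistInv χ Y
      left_inv := fun _ => rfl
      right_inv := fun _ => rfl })
    (fun _ => mod_hom_ext fun _ => rfl)

/-- Restrictions are invariant under the twists. -/
noncomputable def twistRes (g : G) : A.res ⋙ A.twist g ≅ A.res :=
  NatIso.ofComponents (fun Y => mkIso (M := (A.twist g).obj (A.res.obj Y))
    (N := A.res.obj Y)
    { toFun := fun y => (show Y.obj from op (A.grp g) • (show Y.obj from y))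
      map_add' := fun v w => smul_add (A := Y.obj) _ _ _
      map_smul' := fun a y => by
        change op (A.grp g) • op (A.inc (A.ρ g a.unop)) • (show Y.obj from y) =
          op (A.inc a.unop) • op (A.grp g) • _
        rw [← op_mul_smul, ← op_mul_smul, grp_mul_inc]
      invFun := fun y => (show Y.obj from op (A.grp g⁻¹) • (show Y.obj from y))
      left_inv := fun y => by
        change op (A.grp g⁻¹) • op (A.grp g) • (show Y.obj from y) = y
        rw [← op_mul_smul, ← map_mul, mul_inv_cancel, map_one, op_one, one_smul]
      right_inv := fun y => by
        change op (A.grp g) • op (A.grp g⁻¹) • (show Y.obj from y) = y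
        rw [← op_mul_smul, ← map_mul, inv_mul_cancel, map_one, op_one, one_smul] })
    (fun {Y Z} f => mod_hom_ext fun w =>
      (map_smul f.hom.hom (op (A.grp g)) (show Y.obj from w)).symm)

theorem ind_triangle (M : A.Mod) :
    A.ind.map (A.indUnit.app M) ≫ A.indCounit.app (A.ind.obj M) = 𝟙 _ :=
  mod_hom_ext fun w => A.sum_indSingle M w

theorem ind_triangle' (Y : A.skew.Mod) :
    A.indUnit.app (A.res.obj Y) ≫ A.res.map (A.indCounit.app Y) = 𝟙 _ :=
  mod_hom_ext fun y => by
    change A.indCounitFun Y (A.indSingle (A.res.obj Y) y) = y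
    rw [indCounitFun, Finset.sum_eq_single 1]
    · refine (congrArg (fun z : Y.obj => op (A.grp 1) • z) (A.indSingle_one (A.res.obj Y) y)).trans ?_
      rw [map_one, op_one]
      exact one_smul _ (show Y.obj from y)
    · intro x _ hx
      refine (congrArg (fun z : Y.obj => op (A.grp x) • z)
        (A.indSingle_ne (A.res.obj Y) y hx)).trans ?_
      exact smul_zero (A := Y.obj) _
    · exact fun h => (h (Finset.mem_univ _)).elim

theorem res_triangle (Y : A.skew.Mod) :
    A.res.map (A.resUnit.app Y) ≫ A.resCounit.app (A.res.obj Y) = 𝟙 _ :=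
  mod_hom_ext fun y => by
    change op (A.grp 1⁻¹) • (show Y.obj from y) = y
    rw [inv_one, map_one, op_one, one_smul]

theorem res_triangle' (M : A.Mod) :
    A.resUnit.app (A.ind.obj M) ≫ A.ind.map (A.resCounit.app M) = 𝟙 _ :=
  mod_hom_ext fun w => funext fun x => by
    change (op (A.grp x⁻¹) • (show A.Ind M from w) : A.Ind M) 1 = (show A.Ind M from w) x
    rw [ind_grp_smul, inv_inv, one_mul]

/-- The induction is left adjoint to the restriction. -/
noncomputable def indAdj : A.ind ⊣ A.res := Adjunction.mkOfUnitCounit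
  { unit := A.indUnit
    counit := A.indCounit
    left_triangle := by
      ext M : 2
      simpa using A.ind_triangle M
    right_triangle := by
      ext Y : 2
      simpa using A.ind_triangle' Y }

/-- The restriction is left adjoint to the induction. -/
noncomputable def resAdj : A.res ⊣ A.ind := Adjunction.mkOfUnitCounit
  { unit := A.resUnit
    counit := A.resCounit
    left_triangle := by
      ext Y : 2
      simpa using A.res_triangle Y
    right_triangle := by
      ext M : 2
      simpa using A.res_triangle' M }

/-- Exactness of both functors comes from the two adjunctions. -/
instance : Limits.PreservesFiniteColimits A.ind :=
  have := A.indAdj.leftAdjoint_preservesColimits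
  ⟨fun _ => inferInstance⟩

instance : Limits.PreservesFiniteLimits A.res :=
  have := A.indAdj.rightAdjoint_preservesLimits
  ⟨fun _ => inferInstance⟩

instance : Limits.PreservesFiniteColimits A.res :=
  have := A.resAdj.leftAdjoint_preservesColimits
  ⟨fun _ => inferInstance⟩

instance : Limits.PreservesFiniteLimits A.ind :=
  have := A.resAdj.rightAdjoint_preservesLimits
  ⟨fun _ => inferInstance⟩

end Skew
end GAlgebra

/-! ### Orthogonality of characters and the two crossed pairs. -/

namespace GAlgebra

open MulOpposite

section CharacterSums

variable {k G : Type u} [Field k] [Group G] [Fintype G]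

/-- Translating the sum by some `g` with χ(g) ≠ 1 multiplies it by χ(g) without changing it. -/
theorem sum_character_eq_zero {χ : G →* kˣ} (hχ : χ ≠ 1) : ∑ x, ((χ x : kˣ) : k) = 0 := by
  obtain ⟨g, hg⟩ : ∃ g, χ g ≠ 1 := by
    by_contra! h
    exact hχ (MonoidHom.ext h)
  have h : ((χ g : kˣ) : k) * ∑ x, ((χ x : kˣ) : k) = ∑ x, ((χ x : kˣ) : k) := by
    rw [Finset.mul_sum, ← Equiv.sum_comp (Equiv.mulLeft g) (fun x => ((χ x : kˣ) : k))]
    exact Finset.sum_congr rfl fun x _ => by simp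
  rw [← sub_eq_zero, ← sub_one_mul, mul_eq_zero, sub_eq_zero] at h
  exact h.resolve_left fun h1 => hg (Units.ext h1)

theorem sum_character_mul_inv {χ ψ : G →* kˣ} (h : χ ≠ ψ) :
    ∑ x, ((χ x : kˣ) : k) * ((ψ x⁻¹ : kˣ) : k) = 0 := by
  rw [← sum_character_eq_zero (mul_inv_eq_one.not.2 h)]
  exact Finset.sum_congr rfl fun x _ => by simp

variable [Fintype (G →* kˣ)]

-- The previous relation for the character group, applied to evaluation at `x`, which is nontrivial
-- by injectivity.
omit [Fintype G] in
theorem sum_eval_eq_zero (hinj : Function.Injective (doubleDual k G)) {x : G} (hx : x ≠ 1) :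
    ∑ χ : G →* kˣ, ((χ x : kˣ) : k) = 0 := by
  refine sum_character_eq_zero (χ := doubleDual k G x) fun h => hx (hinj ?_)
  rw [h, map_one]

/-- Sum χ(x) over all pairs in both orders: only x = 1 survives in one, only χ = 1 in the other. -/
theorem card_characters (hinj : Function.Injective (doubleDual k G)) :
    (Fintype.card (G →* kˣ) : k) = Fintype.card G := by
  classical
  have h1 : ∑ x : G, ∑ χ : G →* kˣ, ((χ x : kˣ) : k) = Fintype.card (G →* kˣ) := by
    rw [Finset.sum_eq_single 1 (fun x _ hx => sum_eval_eq_zero hinj hx)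
      (fun h => (h (Finset.mem_univ _)).elim)]
    simp
  have h2 : ∑ χ : G →* kˣ, ∑ x : G, ((χ x : kˣ) : k) = Fintype.card G := by
    rw [Finset.sum_eq_single 1 (fun χ _ hχ => sum_character_eq_zero hχ)
      (fun h => (h (Finset.mem_univ _)).elim)]
    simp
  rw [← h1, Finset.sum_comm, h2]

theorem sum_eval_one (hinj : Function.Injective (doubleDual k G)) :
    ∑ χ : G →* kˣ, ((χ 1 : kˣ) : k) = Fintype.card G := by
  rw [← card_characters hinj]
  simp

end CharacterSums

section Pairs

variable {k G : Type u} [Field k] [Group G]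

theorem natCast_sc {A : GAlgebra k G} {M : A.Mod} (n : ℕ) (m : M.obj) :
    sc (n : k) m = n • m := by
  induction n with
  | zero => rw [Nat.cast_zero, zero_sc, zero_smul]
  | succ n ih => rw [Nat.cast_succ, add_sc, ih, one_sc, succ_nsmul]

variable [Fintype G] (A : GAlgebra k G)

omit [Fintype G] in
theorem ind_sum_apply {ι : Type*} (s : Finset ι) {M : A.Mod} (w : ι → A.Ind M) (y : G) :
    (∑ i ∈ s, w i) y = ∑ i ∈ s, w i y :=
  map_sum (Pi.evalAddMonoidHom (fun _ : G => M.obj) y) _ _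

theorem grp_inv_smul_smul {Y : A.skew.Mod} (x : G) (y : Y.obj) :
    op (A.grp x) • op (A.grp x⁻¹) • y = y := by
  rw [← op_mul_smul, ← map_mul, inv_mul_cancel, map_one, op_one, one_smul]

/-- Each of the |G| summands is `y` acted on by `x⁻¹` and then by `x`. Once |G| is invertible, this
splits the counit. -/
theorem indCounitFun_resUnitFun (Y : A.skew.Mod) (y : Y.obj) :
    A.indCounitFun Y (A.resUnitFun Y y) = sc (Fintype.card G : k) y := by
  rw [natCast_sc, ← Finset.card_univ, ← Finset.sum_const]
  exact Finset.sum_congr rfl fun x _ => A.grp_inv_smul_smul x y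

theorem indCounitFun_ind (M : A.Mod) (w : A.Ind (A.res.obj (A.ind.obj M))) (y : G) :
    (show A.Ind M from A.indCounitFun (A.ind.obj M) w) y =
      ∑ g, (show A.Ind M from w (g⁻¹ * y)) g := by
  rw [indCounitFun]
  refine (A.ind_sum_apply _ _ y).trans ?_
  rw [← Equiv.sum_comp ((Equiv.inv G).trans (Equiv.mulRight y))]
  refine Finset.sum_congr rfl fun g _ => ?_
  refine (A.ind_grp_smul M _ _ y).trans ?_
  have : y * (g⁻¹ * y)⁻¹ = g := by group
  exact congrArg _ this

/-- Left translation by `g` and multiplication by `χ⁻¹` commute up to χ(g), since χ⁻¹(g⁻¹y) = χ(g)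
χ⁻¹(y). -/
theorem indChar_inv_mul_indTwistFun (χ : G →* kˣ) (g : G) (M : A.Mod)
    (w : A.Ind ((A.twist g).obj M)) :
    A.indTwistFun g M (A.indChar χ⁻¹ _ w) =
      op (((χ g : kˣ) : k) • (1 : A.skew)) • A.indChar χ⁻¹ M (A.indTwistFun g M w) := by
  funext y
  rw [sc_ind, indTwistFun_apply, indChar_apply, indChar_apply, indTwistFun_apply]
  refine (A.sc_twist M g _ _).trans (Eq.trans ?_ (sc_sc (M := M) _ _ (w (g⁻¹ * y))).symm)
  congr 1
  rw [← Units.val_mul]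
  simp [mul_comm]

/-- The induction from `A` to the skew-group algebra and the restriction. -/
noncomputable def indPair (hcard : (Fintype.card G : k) ≠ 0) :
    CrossedPair A A.skew (MonoidHom.id (G →* kˣ)) where
  F := A.ind
  H := A.res
  η := A.indUnit
  ε := A.indCounit
  σ := (Fintype.card G : k)⁻¹ • A.resUnit
  π := A.indProj
  lam := A.indTwist
  κ := A.twistInd
  triangle := A.ind_triangle
  section_counit Y := by
    rw [NatTrans.app_smul, Linear.smul_comp]
    refine mod_hom_ext fun y => (smul_hom_apply' _ _ y).trans ?_
    refine (congrArg (sc _) (A.indCounitFun_resUnitFun Y y)).trans ((sc_sc _ _ _).trans ?_)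
    rw [inv_mul_cancel₀ hcard]
    exact one_sc _
  sum_π_lam M := mod_hom_ext fun w => by
    rw [sum_hom_apply]
    refine funext fun y => (A.ind_sum_apply _ _ y).trans (A.indCounitFun_ind M w y).symm
  π_self g M := mod_hom_ext fun m => by
    change A.indSingle _ m (g⁻¹ * g) = m
    rw [inv_mul_cancel, indSingle_one]
  π_ne g h hne M := mod_hom_ext fun m => by
    change A.indSingle _ m (h⁻¹ * g) = 0
    exact A.indSingle_ne _ _ fun e => hne (inv_mul_eq_one.1 e).symm
  lam_mul g h l hl M := mod_hom_ext fun w => funext fun y => by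
    subst hl
    change (show A.Ind _ from w) ((g * h)⁻¹ * y) = (show A.Ind _ from w) (h⁻¹ * (g⁻¹ * y))
    rw [mul_inv_rev, mul_assoc]
  κ_mul χ ψ l hl M := mod_hom_ext fun w => by
    subst hl
    refine Eq.trans ?_ (A.indChar_mul ψ⁻¹ χ⁻¹ M w)
    exact congrArg (A.indChar · M w) (mul_inv_rev χ ψ)
  κ_lam χ g M := mod_hom_ext fun w => by
    refine (A.indChar_inv_mul_indTwistFun χ g M w).trans ?_
    exact (smul_hom_apply' (A := A.skew) ((χ g : kˣ) : k)
      ((A.skew.twist χ).map ((A.indTwist g).hom.app M) ≫ (A.twistInd χ).hom.app M) w).symm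

theorem charProjFun_apply (χ : G →* kˣ) (Y : A.skew.Mod) (w : A.Ind (A.res.obj Y)) :
    A.charProjFun χ Y w = ∑ x, sc ((χ x : kˣ) : k) (op (A.grp x) • (show Y.obj from w x)) :=
  Finset.sum_congr rfl fun x _ =>
    (congrArg (fun z : Y.obj => op (A.grp x) • z) (A.sc_res Y _ (w x))).trans (op_smul_sc _ _ _)

/-- Summing over characters first kills every component except the one at 1. This is the
completeness relation for restriction. -/
theorem sum_charProjFun [Fintype (G →* kˣ)] (hinj : Function.Injective (doubleDual k G))
    (Y : A.skew.Mod) (w : A.Ind (A.res.obj Y)) :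
    ∑ χ : G →* kˣ, A.charProjFun χ Y w = sc (Fintype.card G : k) (show Y.obj from w 1) := by
  rw [Finset.sum_congr rfl fun χ _ => A.charProjFun_apply χ Y w, Finset.sum_comm, Finset.sum_eq_single 1]
  · rw [← sum_sc, sum_eval_one hinj, map_one, op_one]
    exact congrArg _ (one_smul _ (show Y.obj from w 1))
  · intro x _ hx
    rw [← sum_sc, sum_eval_eq_zero hinj hx, zero_sc]
  · exact fun h => (h (Finset.mem_univ _)).elim

/-- In the twist by `ψ` the element `x⁻¹` acts with the extra factor ψ(x⁻¹), so the composite of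
inclusion and projection is a character sum, which yields orthogonality of the twists. -/
theorem charProjFun_resUnitFun (χ ψ : G →* kˣ) (Y : A.skew.Mod)
    (y : ((A.skew.twist ψ).obj Y).obj) :
    A.charProjFun χ Y ((A.ind.map ((A.resTwist ψ).hom.app Y)).hom.hom
      (A.resUnitFun ((A.skew.twist ψ).obj Y) y)) =
      sc (∑ x, ((χ x : kˣ) : k) * ((ψ x⁻¹ : kˣ) : k)) (show Y.obj from y) := by
  refine (A.charProjFun_apply χ Y _).trans (Eq.trans ?_ (sum_sc (M := Y) _ _ _).symm)
  refine Finset.sum_congr rfl fun x _ => ?_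
  have h : (show Y.obj from ((A.ind.map ((A.resTwist ψ).hom.app Y)).hom.hom
      (A.resUnitFun ((A.skew.twist ψ).obj Y) y) : A.Ind (A.res.obj Y)) x) =
      sc ((ψ x⁻¹ : kˣ) : k) (op (A.grp x⁻¹) • (show Y.obj from y)) := by
    refine Eq.trans ?_ (op_smul_smul _ _ _)
    rw [← skew_ρ_grp]
    rfl
  refine (congrArg (fun z : Y.obj => sc ((χ x : kˣ) : k) (op (A.grp x) • z)) h).trans ?_
  rw [op_smul_sc, grp_inv_smul_smul, sc_sc]

/-- The restriction from the skew-group algebra to `A` and the induction. -/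
noncomputable def resPair [Fintype (G →* kˣ)] (hcard : (Fintype.card G : k) ≠ 0)
    (hinj : Function.Injective (doubleDual k G)) :
    CrossedPair A.skew A (doubleDual k G) where
  F := A.res
  H := A.ind
  η := A.resUnit
  ε := A.resCounit
  σ := A.indUnit
  -- Without this factor the diagonal composites would be multiplication by |G|.
  π χ := (Fintype.card G : k)⁻¹ • A.charProj χ
  lam := A.resTwist
  κ := A.twistRes
  triangle := A.res_triangle
  section_counit M := mod_hom_ext fun m => A.indSingle_one M m
  sum_π_lam Y := mod_hom_ext fun w => by
    rw [sum_hom_apply]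
    have h (χ : G →* kˣ) : (A.res.map (((Fintype.card G : k)⁻¹ • A.charProj χ).app Y) ≫
        (A.resTwist χ).hom.app Y).hom.hom w =
        sc (M := Y) (Fintype.card G : k)⁻¹ (A.charProjFun χ Y w) :=
      (smul_hom_apply' _ ((A.charProj χ).app Y) w).trans (A.skew.sc_twist Y χ _ _)
    refine (Finset.sum_congr rfl fun χ _ => h χ).trans ?_
    refine (sc_sum (M := Y) _ _ _).symm.trans ?_
    refine (congrArg (sc (M := Y) _) (A.sum_charProjFun hinj Y w)).trans ?_
    refine (sc_sc (M := Y) _ _ _).trans ?_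
    rw [inv_mul_cancel₀ hcard]
    exact one_sc (M := Y) _
  π_self χ Y := by
    rw [NatTrans.app_smul, Linear.comp_smul, Linear.comp_smul]
    refine mod_hom_ext fun y => (smul_hom_apply' _ _ y).trans ?_
    refine (A.skew.sc_twist Y χ _ _).trans ?_
    refine (congrArg (sc (M := Y) _) (A.charProjFun_resUnitFun χ χ Y y)).trans ?_
    refine (sc_sc (M := Y) _ _ _).trans ?_
    have h : ∑ x, ((χ x : kˣ) : k) * ((χ x⁻¹ : kˣ) : k) = Fintype.card G := by simp
    rw [h, inv_mul_cancel₀ hcard]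
    exact one_sc (M := Y) _
  π_ne χ ψ hne Y := by
    rw [NatTrans.app_smul, Linear.comp_smul, Linear.comp_smul]
    have h : A.resUnit.app ((A.skew.twist ψ).obj Y) ≫ A.ind.map ((A.resTwist ψ).hom.app Y) ≫
        (A.charProj χ).app Y = 0 := mod_hom_ext fun y => by
      refine (A.charProjFun_resUnitFun χ ψ Y y).trans ?_
      rw [sum_character_mul_inv hne]
      exact zero_sc (M := Y) _
    exact (congrArg _ h).trans (smul_zero _)
  lam_mul χ ψ l hl Y := mod_hom_ext fun y => rfl
  κ_mul g h l hl Y := mod_hom_ext fun y => by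
    subst hl
    change op (A.grp (g * h)) • (show Y.obj from y) = op (A.grp h) • op (A.grp g) • _
    rw [map_mul, op_mul_smul]
  κ_lam g χ Y := mod_hom_ext fun y => by
    refine Eq.trans ?_ (smul_hom_apply' _ _ y).symm
    refine Eq.trans ?_ (A.sc_res Y _ _).symm
    change op (A.skew.ρ χ (A.grp g)) • (show Y.obj from y) = _
    rw [skew_ρ_grp]
    exact op_smul_smul _ _ _

end Pairs

end GAlgebra

/-! ### Splitting of idempotents in the bounded derived category. -/

section IdempotentSplitting

open Limits Pretriangulated Triangulated Preadditive

variable {C : Type*} [Category* C]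

/-- The splitting of an endomorphism, necessarily idempotent. -/
def CategoryTheory.EndSplits {X : C} (p : X ⟶ X) : Prop :=
  ∃ (Y : C) (i : Y ⟶ X) (r : X ⟶ Y), i ≫ r = 𝟙 Y ∧ r ≫ i = p

variable [Preadditive C]

/-- An idempotent that differs from a split one by an endomorphism of square zero splits. -/
theorem CategoryTheory.EndSplits.of_sub_sq_eq_zero {X Y : C} {e : X ⟶ X} (he : e ≫ e = e)
    (i : Y ⟶ X) (r : X ⟶ Y) (hir : i ≫ r = 𝟙 Y) (h : (r ≫ i - e) ≫ (r ≫ i - e) = 0) :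
    EndSplits e := by
  have hp : (r ≫ i) ≫ r ≫ i = r ≫ i := by
    rw [Category.assoc, reassoc_of% hir]
  have hs : r ≫ i - (r ≫ i) ≫ e - (e ≫ r ≫ i - e) = 0 := by
    rw [← h]
    simp only [sub_comp, comp_sub, hp, he]
    abel
  -- With p = `r ≫ i`, multiplying the expansion of (p - e)² = 0 by `e` on both sides gives epe = e;
  -- multiplying by p gives pep = p.
  have h1 : e ≫ (r ≫ i) ≫ e = e := by
    have := congr(e ≫ $hs ≫ e)
    simp only [sub_comp, comp_sub, Category.assoc, he, reassoc_of% he, comp_zero, zero_comp] at this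
    rw [Category.assoc]
    rw [sub_self, zero_sub, neg_eq_zero, sub_eq_zero] at this
    exact this
  have h2 : (r ≫ i) ≫ e ≫ (r ≫ i) = r ≫ i := by
    have := congr((r ≫ i) ≫ $hs ≫ (r ≫ i))
    simp only [sub_comp, comp_sub, Category.assoc, reassoc_of% hir, comp_zero, zero_comp] at this
    simp only [Category.assoc]
    rw [sub_self, sub_zero, sub_eq_zero] at this
    exact this.symm
  refine ⟨Y, i ≫ e, e ≫ r, ?_, by simpa using h1⟩
  have := congr(i ≫ $h2 ≫ r)
  simp only [Category.assoc, hir, Category.comp_id, reassoc_of% hir] at this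
  rw [Category.assoc, reassoc_of% he]
  exact this

omit [Preadditive C] in
theorem CategoryTheory.EndSplits.of_iso {X X' : C} (φ : X ≅ X') (p : X ⟶ X)
    (h : EndSplits (φ.inv ≫ p ≫ φ.hom)) : EndSplits p := by
  obtain ⟨Y, i, r, h1, h2⟩ := h
  refine ⟨Y, i ≫ φ.inv, φ.hom ≫ r, by simpa using h1, ?_⟩
  rw [Category.assoc, reassoc_of% h2]
  simp

variable [HasZeroObject C] [HasShift C ℤ] [∀ (n : ℤ), (shiftFunctor C n).Additive]
  [Pretriangulated C]

/-- An idempotent endomorphism of a distinguished triangle whose outer components split has a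
split middle component. -/
theorem CategoryTheory.EndSplits.of_triangle {T : Triangle C} (hT : T ∈ distTriang C) (f : T ⟶ T)
    (hf : f.hom₂ ≫ f.hom₂ = f.hom₂) (h₁ : EndSplits f.hom₁) (h₃ : EndSplits f.hom₃) :
    EndSplits f.hom₂ := by
  obtain ⟨Y₁, i₁, r₁, hir₁, hri₁⟩ := h₁
  obtain ⟨Y₃, i₃, r₃, hir₃, hri₃⟩ := h₃
  -- The candidate image completes the map between the outer images to a triangle. The induced maps
  -- `α` and `β` need not compose to the identity or to `f.hom₂`, and both defects are corrected
  -- below.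
  obtain ⟨Y, a, b, hY⟩ := distinguished_cocone_triangle₂ (i₃ ≫ T.mor₃ ≫ r₁⟦(1 : ℤ)⟧')
  have hc := f.comm₃
  have hi : i₃ ≫ f.hom₃ = i₃ := by rw [← hri₃, reassoc_of% hir₃]
  have hr : r₃ ≫ i₃ ≫ T.mor₃ ≫ r₁⟦(1 : ℤ)⟧' = T.mor₃ ≫ r₁⟦(1 : ℤ)⟧' := by
    rw [reassoc_of% hri₃, ← reassoc_of% hc, ← Functor.map_comp, ← hri₁, Category.assoc, hir₁,
      Category.comp_id]
  obtain ⟨α, hα₁, hα₂⟩ : ∃ α : Y ⟶ T.obj₂, a ≫ α = i₁ ≫ T.mor₁ ∧ b ≫ i₃ = α ≫ T.mor₂ :=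
    complete_distinguished_triangle_morphism₂ _ _ hY hT i₁ i₃ (by
    change (i₃ ≫ T.mor₃ ≫ r₁⟦(1 : ℤ)⟧') ≫ i₁⟦(1 : ℤ)⟧' = i₃ ≫ T.mor₃
    rw [Category.assoc, Category.assoc, ← Functor.map_comp, hri₁, hc, reassoc_of% hi])
  obtain ⟨β, hβ₁, hβ₂⟩ : ∃ β : T.obj₂ ⟶ Y, T.mor₁ ≫ β = r₁ ≫ a ∧ T.mor₂ ≫ r₃ = β ≫ b :=
    complete_distinguished_triangle_morphism₂ _ _ hT hY r₁ r₃ hr.symm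
  have hab : IsIso (α ≫ β) := by
    let g : Triangle.mk a b (i₃ ≫ T.mor₃ ≫ r₁⟦(1 : ℤ)⟧') ⟶
        Triangle.mk a b (i₃ ≫ T.mor₃ ≫ r₁⟦(1 : ℤ)⟧') :=
      { hom₁ := 𝟙 _
        hom₂ := α ≫ β
        hom₃ := 𝟙 _
        comm₁ := by
          change a ≫ α ≫ β = 𝟙 _ ≫ a
          rw [reassoc_of% hα₁, hβ₁, reassoc_of% hir₁, Category.id_comp]
        comm₂ := by
          change b ≫ 𝟙 _ = (α ≫ β) ≫ b
          rw [Category.assoc, ← hβ₂, ← reassoc_of% hα₂, hir₃]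
        comm₃ := by
          rw [CategoryTheory.Functor.map_id, Category.comp_id, Category.id_comp] }
    exact isIso₂_of_isIso₁₃ g hY hY (inferInstanceAs (IsIso (𝟙 Y₁)))
      (inferInstanceAs (IsIso (𝟙 Y₃)))
  have ha : a ≫ inv (α ≫ β) = a := by
    rw [IsIso.comp_inv_eq, reassoc_of% hα₁, hβ₁, reassoc_of% hir₁]
  have hb : inv (α ≫ β) ≫ b = b := by
    rw [IsIso.inv_comp_eq, Category.assoc, ← hβ₂, ← reassoc_of% hα₂, hir₃, Category.comp_id]
  refine EndSplits.of_sub_sq_eq_zero hf α (β ≫ inv (α ≫ β)) (by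
    rw [← Category.assoc]
    exact IsIso.hom_inv_id (α ≫ β)) ?_
  have hz₁ : T.mor₁ ≫ ((β ≫ inv (α ≫ β)) ≫ α - f.hom₂) = 0 := by
    rw [comp_sub, sub_eq_zero, Category.assoc, reassoc_of% hβ₁, reassoc_of% ha, hα₁,
      reassoc_of% hri₁, f.comm₁]
  have hz₂ : ((β ≫ inv (α ≫ β)) ≫ α - f.hom₂) ≫ T.mor₂ = 0 := by
    rw [sub_comp, sub_eq_zero, Category.assoc, Category.assoc, ← hα₂, reassoc_of% hb,
      ← reassoc_of% hβ₂, hri₃, f.comm₂]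
  -- The difference of the two idempotents factors through `T.mor₂` and is killed by it, so its
  -- square is zero.
  obtain ⟨s, hs⟩ := T.yoneda_exact₂ hT _ hz₁
  conv_lhs => arg 2; rw [hs]
  rw [← Category.assoc, hz₂, zero_comp]

end IdempotentSplitting

namespace DerivedCategory

open Limits Pretriangulated Triangulated TStructure

variable {C : Type*} [Category* C] [Abelian C] [HasDerivedCategory C]

/-- The single functor is fully faithful, and idempotents split in an abelian category. -/
theorem endSplits_of_isGE_of_isLE_self (a : ℤ) (X : DerivedCategory C) [X.IsGE a]
    [X.IsLE a] (e : X ⟶ X) (he : e ≫ e = e) : EndSplits e := by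
  obtain ⟨Y, ⟨φ⟩⟩ := exists_iso_singleFunctor_obj_of_isGE_of_isLE X a
  refine EndSplits.of_iso φ e ?_
  obtain ⟨p, hp⟩ := (singleFunctor C a).map_surjective (φ.inv ≫ e ≫ φ.hom)
  obtain ⟨Z, i, r, h1, h2⟩ := IsIdempotentComplete.idempotents_split Y p
    ((singleFunctor C a).map_injective (by rw [Functor.map_comp, hp]; simp [reassoc_of% he]))
  refine ⟨_, (singleFunctor C a).map i, (singleFunctor C a).map r, ?_, ?_⟩
  · rw [← Functor.map_comp, h1, CategoryTheory.Functor.map_id]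
  · rw [← Functor.map_comp, h2, hp]

/-- Induction on the amplitude: truncation cuts off the lowest degree, and is functorial, so `e`
acts on the truncation triangle with idempotent outer components. -/
theorem endSplits_of_isGE_of_isLE (n : ℕ) (a : ℤ) (X : DerivedCategory C) [X.IsGE a]
    [X.IsLE (a + n)] (e : X ⟶ X) (he : e ≫ e = e) : EndSplits e := by
  induction n generalizing a X with
  | zero =>
    have : X.IsLE a := by simpa using (inferInstance : X.IsLE (a + (0 : ℕ)))
    exact endSplits_of_isGE_of_isLE_self a X e he
  | succ n ih =>
    have h := (t (C := C)).triangleLTGE_distinguished (a + 1) X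
    have : X.IsLE (a + 1 + n) := by
      have e : a + 1 + n = a + (n + 1 : ℕ) := by push_cast; ring
      rw [e]
      infer_instance
    refine EndSplits.of_triangle h (((t (C := C)).triangleLTGE (a + 1)).map e) he ?_ ?_
    · refine endSplits_of_isGE_of_isLE_self a ((t.truncLT (a + 1)).obj X) ((t.truncLT (a + 1)).map e) ?_
      rw [← Functor.map_comp, he]
    · refine ih (a + 1) ((t.truncGE (a + 1)).obj X) ((t.truncGE (a + 1)).map e) ?_
      rw [← Functor.map_comp, he]

theorem endSplits_of_bounded {X : DerivedCategory C} (hX : (t (C := C)).bounded X) (e : X ⟶ X)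
    (he : e ≫ e = e) : EndSplits e := by
  obtain ⟨⟨a, ha⟩, ⟨b, hb⟩⟩ := hX
  -- If b < a, the truncated difference only weakens the upper bound to a.
  have := (t (C := C)).isLE_of_le X b (a + (b - a).toNat) (by lia)
  exact endSplits_of_isGE_of_isLE (b - a).toNat a X e he

end DerivedCategory

/-! ### Passing to the corner of a full invariant idempotent. -/

namespace GAlgebra

open Limits Pretriangulated

section Corner

variable {k Γ : Type u} [Field k] [Group Γ] {A : GAlgebra k Γ}

/-- The structure of an invariant object on the image of an invariant idempotent. -/
noncomputable def Invariant.ofRetract {T T' : A.D} (s : A.Invariant T) (i : T' ⟶ T) (r : T ⟶ T')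
    (hir : i ≫ r = 𝟙 T')
    (hf : ∀ g, (A.derTwist g⁻¹).map (r ≫ i) ≫ (s.ι g).hom = (s.ι g).hom ≫ r ≫ i) :
    A.Invariant T' where
  ι g :=
    { hom := (A.derTwist g⁻¹).map i ≫ (s.ι g).hom ≫ r
      inv := i ≫ (s.ι g).inv ≫ (A.derTwist g⁻¹).map r
      hom_inv_id := by
        have h := hf g
        simp only [Category.assoc]
        rw [← reassoc_of% h, Iso.hom_inv_id_assoc, ← Functor.map_comp, ← Functor.map_comp,
          Category.assoc, hir, Category.comp_id, hir, CategoryTheory.Functor.map_id]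
      inv_hom_id := by
        have h := hf g
        simp only [Category.assoc]
        rw [← Functor.map_comp_assoc, reassoc_of% h, Iso.inv_hom_id_assoc, hir, Category.comp_id,
          hir] }
  ι_mul g h := by
    have h1 := (A.derTwistComp h⁻¹ g⁻¹ (g * h)⁻¹ (mul_inv_rev g h)).hom.naturality i
    have h2 := s.ι_mul g h
    have h3 := hf g
    simp only [Functor.comp_map] at h1
    dsimp only
    rw [← reassoc_of% h1, reassoc_of% h2, ← Functor.map_comp_assoc, ← Functor.map_comp_assoc]
    simp only [Category.assoc]
    have h4 : (A.derTwist g⁻¹).map r ≫ (A.derTwist g⁻¹).map i ≫ (s.ι g).hom ≫ r =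
        (s.ι g).hom ≫ r := by
      rw [← Functor.map_comp_assoc, reassoc_of% h3, hir, Category.comp_id]
    rw [Functor.map_comp, Functor.map_comp, Functor.map_comp, Functor.map_comp]
    simp only [Category.assoc]
    rw [h4]

/-- The two families assemble into a retraction of a finite power of `T'` onto `T`. -/
theorem triangEnvelope_of_sum_retracts {T T' : A.D} {J : Type*} [Fintype J] (a : J → (T' ⟶ T))
    (b : J → (T ⟶ T')) (h : ∑ j, b j ≫ a j = 𝟙 T) :
    (ObjectProperty.singleton T').triangEnvelope T := by
  let e := Fintype.equivFin J
  have h1 : (ObjectProperty.singleton T').triangEnvelope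
      (∏ᶜ fun _ : Fin (Fintype.card J) => T') :=
    ObjectProperty.prop_product _ fun _ => ObjectProperty.le_triangEnvelope _ _ ⟨()⟩
  have h2 := (ObjectProperty.singleton T').triangEnvelope.prop_of_iso
    (biproduct.isoProduct (fun _ : Fin (Fintype.card J) => T')).symm h1
  refine ObjectProperty.prop_of_retract _ (Y := ⨁ fun _ : Fin (Fintype.card J) => T')
    { i := biproduct.lift fun j => b (e.symm j)
      r := biproduct.desc fun j => a (e.symm j)
      retract := ?_ } h2
  rw [biproduct.lift_desc, e.symm.sum_comp (fun j => b j ≫ a j), h]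

theorem IsTilting.of_retract {T T' : A.D} (hT : A.IsTilting T) (i : T' ⟶ T) (r : T ⟶ T')
    (hir : i ≫ r = 𝟙 T') {J : Type*} [Fintype J] (a b : J → (T ⟶ T))
    (h : ∑ j, b j ≫ (r ≫ i) ≫ a j = 𝟙 T) : A.IsTilting T' where
  thick_eq := by
    have hT' : (ObjectProperty.singleton T').triangEnvelope T :=
      triangEnvelope_of_sum_retracts (fun j => i ≫ a j) (fun j => b j ≫ r) (by simpa using h)
    rw [← hT.thick_eq]
    refine le_antisymm ((ObjectProperty.triangEnvelope_le_iff _).2 ?_)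
      ((ObjectProperty.triangEnvelope_le_iff _).2 ?_)
    · rintro _ ⟨⟩
      exact ObjectProperty.prop_of_retract _ ⟨i, r, hir⟩ (ObjectProperty.le_triangEnvelope _ _ ⟨()⟩)
    · rintro _ ⟨⟩
      exact hT'
  rigid n hn f := by
    have h1 := hT.rigid n hn (r ≫ f ≫ i⟦n⟧')
    have h2 := congr(i ≫ $h1 ≫ r⟦n⟧')
    rw [zero_comp, comp_zero] at h2
    rw [← h2]
    simp only [Category.assoc]
    rw [reassoc_of% hir, ← Functor.map_comp, hir, CategoryTheory.Functor.map_id, Category.comp_id]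

/-- A derived equivalence passes to the corner of a full invariant idempotent. -/
theorem DerEquiv.of_corner {B C : GAlgebra k Γ} (h : A.DerEquiv C) {θ : C}
    (hθ : IsIdempotentElem θ) (hG : ∀ g, C.ρ g θ = θ) {J : Type*} [Fintype J] (α β : J → C)
    (hfull : ∑ j, α j * θ * β j = 1) (hB : B.IsGIso (C.corner hθ hG)) : A.DerEquiv B := by
  obtain ⟨T, s, hT, e, he⟩ := h
  obtain ⟨c, hc⟩ := hB
  have hTb : A.Db T := by
    rw [← hT.thick_eq]
    exact ObjectProperty.le_triangEnvelope _ _ ⟨()⟩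
  obtain ⟨T', i, r, hir, hri⟩ := DerivedCategory.endSplits_of_bounded hTb (e.symm θ) (by
    change e.symm θ * e.symm θ = e.symm θ
    rw [← map_mul, hθ])
  have hact (g : Γ) : s.act g (e.symm θ) = e.symm θ := by
    rw [AlgEquiv.eq_symm_apply, he, AlgEquiv.apply_symm_apply, hG]
  have hf (g : Γ) : (A.derTwist g⁻¹).map (r ≫ i) ≫ (s.ι g).hom = (s.ι g).hom ≫ r ≫ i := by
    rw [hri, ← Iso.inv_comp_eq]
    exact hact g
  refine ⟨T', s.ofRetract i r hir hf, hT.of_retract i r hir (fun j => e.symm (α j))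
    (fun j => e.symm (β j)) ?_, ?_⟩
  -- Multiplication in `End T` reverses composition, hence `β` comes first in the composite.
  · have h1 := congrArg e.symm hfull
    rw [map_sum, map_one] at h1
    refine Eq.trans (Finset.sum_congr rfl fun j _ => ?_) h1
    rw [hri, map_mul, map_mul]
    rfl
  have hmem (φ : End T') : e (r ≫ φ ≫ i) ∈ Subsemigroup.corner θ := by
    refine (Subsemigroup.mem_corner_iff hθ).2 ⟨?_, ?_⟩
    · refine Eq.trans ?_ (congrArg e (show e.symm θ * (show End T from r ≫ φ ≫ i) = _ from ?_))
      · rw [map_mul, AlgEquiv.apply_symm_apply]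
      · change (r ≫ φ ≫ i) ≫ e.symm θ = r ≫ φ ≫ i
        rw [← hri, Category.assoc, Category.assoc, reassoc_of% hir]
    · refine Eq.trans ?_ (congrArg e (show (show End T from r ≫ φ ≫ i) * e.symm θ = _ from ?_))
      · rw [map_mul, AlgEquiv.apply_symm_apply]
      · change e.symm θ ≫ r ≫ φ ≫ i = r ≫ φ ≫ i
        rw [← hri, Category.assoc, reassoc_of% hir]
  let toCorner (φ : End T') : hθ.Corner := ⟨e (r ≫ φ ≫ i), hmem φ⟩
  let ofCorner (x : hθ.Corner) : End T' := i ≫ e.symm (C.cornerVal hθ x) ≫ r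
  let E : End T' ≃ₐ[k] C.corner hθ hG := AlgEquiv.ofLinearEquiv
    { toFun := toCorner
      map_add' := fun φ ψ => C.cornerVal_injective hθ (by
        change e (r ≫ (φ + ψ) ≫ i) = e (r ≫ φ ≫ i) + e (r ≫ ψ ≫ i)
        rw [← map_add]
        congr 1
        refine (congrArg (r ≫ ·) (Preadditive.add_comp _ _ _ φ ψ i)).trans ?_
        exact Preadditive.comp_add _ _ _ _ _ _)
      map_smul' := fun a φ => C.cornerVal_injective hθ (by
        change e (r ≫ (a • φ) ≫ i) = a • e (r ≫ φ ≫ i)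
        rw [← map_smul]
        congr 1
        refine (congrArg (r ≫ ·) (Linear.smul_comp _ _ _ a φ i)).trans ?_
        exact Linear.comp_smul _ _ _ _ _ _)
      invFun := ofCorner
      left_inv := fun φ => by
        change i ≫ e.symm (e (r ≫ φ ≫ i)) ≫ r = φ
        rw [AlgEquiv.symm_apply_apply]
        simp only [Category.assoc, hir]
        rw [reassoc_of% hir]
        exact Category.comp_id _
      right_inv := fun x => C.cornerVal_injective hθ (by
        change e (r ≫ (i ≫ e.symm (C.cornerVal hθ x) ≫ r) ≫ i) = C.cornerVal hθ x
        have hx := (Subsemigroup.mem_corner_iff hθ).1 x.2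
        have h1 : r ≫ (i ≫ e.symm (C.cornerVal hθ x) ≫ r) ≫ i =
            e.symm (θ * (C.cornerVal hθ x * θ)) := by
          rw [map_mul, map_mul]
          change _ = (e.symm θ ≫ e.symm (C.cornerVal hθ x)) ≫ e.symm θ
          rw [← hri]
          simp only [Category.assoc]
        rw [h1, AlgEquiv.apply_symm_apply]
        exact (congrArg (θ * ·) hx.2).trans hx.1) }
    (C.cornerVal_injective hθ (by
      change e (r ≫ 𝟙 T' ≫ i) = θ
      rw [Category.id_comp, hri, AlgEquiv.apply_symm_apply]))
    (fun φ ψ => C.cornerVal_injective hθ (by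
      change e (r ≫ (ψ ≫ φ) ≫ i) = e (r ≫ φ ≫ i) * e (r ≫ ψ ≫ i)
      rw [← map_mul]
      congr 1
      change _ = (r ≫ ψ ≫ i) ≫ r ≫ φ ≫ i
      simp only [Category.assoc]
      rw [reassoc_of% hir]))
  have hEv (φ : End T') : C.cornerVal hθ (E φ) = e (r ≫ φ ≫ i) := rfl
  have hE (g : Γ) (φ : End T') : E ((s.ofRetract i r hir hf).act g φ) =
      (C.corner hθ hG).ρ g (E φ) := C.cornerVal_injective hθ (by
    refine Eq.trans ?_ (C.cornerVal_corner_ρ hθ hG g (E φ)).symm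
    refine (hEv _).trans (Eq.trans ?_ (congrArg (C.ρ g) (hEv φ)).symm)
    rw [← he]
    congr 1
    change r ≫ ((i ≫ (s.ι g).inv ≫ (A.derTwist g⁻¹).map r) ≫ (A.derTwist g⁻¹).map φ ≫
      ((A.derTwist g⁻¹).map i ≫ (s.ι g).hom ≫ r)) ≫ i = (s.ι g).inv ≫ (A.derTwist g⁻¹).map (r ≫ φ ≫ i) ≫ (s.ι g).hom
    have h1 : (r ≫ i) ≫ (s.ι g).inv = (s.ι g).inv ≫ (A.derTwist g⁻¹).map (r ≫ i) := by
      rw [Iso.comp_inv_eq, Category.assoc, hf, Iso.inv_hom_id_assoc]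
    have h2 : (A.derTwist g⁻¹).map i ≫ (A.derTwist g⁻¹).map r = 𝟙 _ := by
      rw [← Functor.map_comp, hir, CategoryTheory.Functor.map_id]
    have h3 := hf g
    simp only [Category.assoc, Functor.map_comp] at h1 h3 ⊢
    rw [← h3, reassoc_of% h1, reassoc_of% h2, reassoc_of% h2])
  refine ⟨E.trans c.symm, fun g φ => ?_⟩
  change c.symm (E _) = B.ρ g (c.symm (E φ))
  rw [AlgEquiv.symm_apply_eq, hc, AlgEquiv.apply_symm_apply, hE]

end Corner

end GAlgebra

/-! ### The iterated skew-group algebra and its averaging idempotent. -/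

namespace GAlgebra

section DoubleSkew

variable {k G : Type u} [Field k] [Group G] [Fintype G] [Fintype (G →* kˣ)]

/-- A `G`-algebra `C` that is generated by a `G`-algebra `B`, a copy of the group `G` and a copy of
its character group, with the relations of the iterated skew-group algebra. -/
structure DoubleSkew (B C : GAlgebra k G) where
  /-- the embedding of the algebra -/
  ι : B →ₐ[k] C
  /-- the embedding of the group -/
  u : G →* C
  /-- the embedding of the character group -/
  v : (G →* kˣ) →* C
  u_ι (g : G) (b : B) : u g * ι b = ι (B.ρ g b) * u g
  v_ι (χ : G →* kˣ) (b : B) : v χ * ι b = ι b * v χ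
  v_u (χ : G →* kˣ) (g : G) : v χ * u g = ((χ g : kˣ) : k) • (u g * v χ)
  ρ_ι (g : G) (b : B) : C.ρ g (ι b) = ι b
  ρ_u (g h : G) : C.ρ g (u h) = u h
  ρ_v (g : G) (χ : G →* kˣ) : C.ρ g (v χ) = ((χ g : kˣ) : k) • v χ
  induction_on (P : C → Prop) (c : C) (h : ∀ b g χ, P (ι b * u g * v χ))
    (hadd : ∀ x y, P x → P y → P (x + y)) : P c
  -- The only freeness needed; it gives injectivity of the map from `B` to the corner.
  ι_mul_sum (b : B) : ι b * ∑ χ, v χ = 0 → b = 0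

namespace DoubleSkew

variable {B C : GAlgebra k G} (S : DoubleSkew B C)

/-- The idempotent given by the group. -/
def θ : C := (Fintype.card G : k)⁻¹ • ∑ g, S.u g

/-- The idempotent given by the character group. -/
def p : C := (Fintype.card G : k)⁻¹ • ∑ χ, S.v χ

theorem u_mul_θ (g : G) : S.u g * S.θ = S.θ := by
  rw [θ, mul_smul_comm, Finset.mul_sum, ← Equiv.sum_comp (Equiv.mulLeft g) S.u]
  simp

theorem θ_mul_u (g : G) : S.θ * S.u g = S.θ := by
  rw [θ, smul_mul_assoc, Finset.sum_mul, ← Equiv.sum_comp (Equiv.mulRight g) S.u]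
  simp

theorem v_mul_p (χ : G →* kˣ) : S.v χ * S.p = S.p := by
  rw [p, mul_smul_comm, Finset.mul_sum, ← Equiv.sum_comp (Equiv.mulLeft χ) S.v]
  simp

theorem p_mul_ι (b : B) : S.p * S.ι b = S.ι b * S.p := by
  rw [p, smul_mul_assoc, mul_smul_comm, Finset.sum_mul, Finset.mul_sum]
  simp_rw [S.v_ι]

theorem ρ_θ (g : G) : C.ρ g S.θ = S.θ := by
  rw [θ, map_smul, map_sum]
  simp_rw [S.ρ_u]

theorem u_mul_ρ_p (g : G) : S.u g * C.ρ g S.p = S.p * S.u g := by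
  rw [p, map_smul, map_sum, mul_smul_comm, smul_mul_assoc, Finset.mul_sum, Finset.sum_mul]
  simp_rw [S.ρ_v, S.v_u, mul_smul_comm]

theorem p_u_p (g : G) : S.p * S.u g * S.p =
    ((Fintype.card G : k)⁻¹ * ∑ χ : G →* kˣ, ((χ g : kˣ) : k)) • (S.u g * S.p) := by
  conv_lhs => arg 1; rw [p, smul_mul_assoc, Finset.sum_mul]
  simp_rw [S.v_u]
  rw [smul_mul_assoc, Finset.sum_mul]
  simp_rw [smul_mul_assoc, mul_assoc, S.v_mul_p]
  rw [← Finset.sum_smul, smul_smul]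

variable (hcard : (Fintype.card G : k) ≠ 0)
include hcard

theorem θ_mul_θ : S.θ * S.θ = S.θ := by
  conv_lhs => arg 1; rw [θ]
  rw [smul_mul_assoc, Finset.sum_mul]
  simp_rw [S.u_mul_θ]
  rw [Finset.sum_const, Finset.card_univ, ← Nat.cast_smul_eq_nsmul k, smul_smul,
    inv_mul_cancel₀ hcard, one_smul]

theorem isIdempotentElem_θ : IsIdempotentElem S.θ := S.θ_mul_θ hcard

/-- Moving v_χ past the group elements produces the sum of the values of χ, so only χ = 1
contributes. With `p_θ_p`, the idempotents are equivalent up to the factor |G|. -/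
theorem θ_p_θ : S.θ * S.p * S.θ = (Fintype.card G : k)⁻¹ • S.θ := by
  have h (χ : G →* kˣ) : S.θ * S.v χ * S.θ =
      ((Fintype.card G : k)⁻¹ * ∑ g : G, ((χ g : kˣ) : k)) • (S.θ * S.v χ) := by
    rw [mul_assoc]
    conv_lhs => arg 2; rw [θ, mul_smul_comm, Finset.mul_sum]
    simp_rw [S.v_u]
    rw [mul_smul_comm, Finset.mul_sum]
    simp_rw [mul_smul_comm, ← mul_assoc, S.θ_mul_u]
    rw [← Finset.sum_smul, smul_smul]
  rw [p, mul_smul_comm, smul_mul_assoc, Finset.mul_sum, Finset.sum_mul]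
  simp_rw [h]
  rw [Finset.sum_eq_single 1]
  · simp [hcard]
  · intro χ _ hχ
    rw [sum_character_eq_zero hχ, mul_zero, zero_smul]
  · simp

variable (hinj : Function.Injective (doubleDual k G))
include hinj

/-- The normalization of `p` is by |G| although the sum runs over characters; the two orders agree
in `k` by `card_characters`. -/
theorem p_mul_p : S.p * S.p = S.p := by
  conv_lhs => arg 1; rw [p]
  rw [smul_mul_assoc, Finset.sum_mul]
  simp_rw [S.v_mul_p]
  rw [Finset.sum_const, Finset.card_univ, ← Nat.cast_smul_eq_nsmul k, smul_smul,
    card_characters hinj, inv_mul_cancel₀ hcard, one_smul]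

omit hcard in
theorem p_u_p_ne {g : G} (hg : g ≠ 1) : S.p * S.u g * S.p = 0 := by
  rw [S.p_u_p, sum_eval_eq_zero hinj hg, mul_zero, zero_smul]

theorem p_θ_p : S.p * S.θ * S.p = (Fintype.card G : k)⁻¹ • S.p := by
  rw [θ, mul_smul_comm, smul_mul_assoc, Finset.mul_sum, Finset.sum_mul, Finset.sum_eq_single 1]
  · rw [map_one, mul_one, S.p_mul_p hcard hinj]
  · intro g _ hg
    exact S.p_u_p_ne hinj hg
  · simp

-- The conjugates of `p` are the sums |G|⁻¹ ∑ χ(g⁻¹) v_χ, and summing over g leaves the term χ = 1.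
omit hinj in
theorem sum_u_p_u : ∑ g, S.u g * S.p * S.u g⁻¹ = 1 := by
  have h (g : G) : S.u g * S.p * S.u g⁻¹ =
      (Fintype.card G : k)⁻¹ • ∑ χ : G →* kˣ, ((χ g⁻¹ : kˣ) : k) • S.v χ := by
    rw [p, mul_smul_comm, smul_mul_assoc, Finset.mul_sum, Finset.sum_mul]
    congr 1
    refine Finset.sum_congr rfl fun χ _ => ?_
    rw [mul_assoc, S.v_u, mul_smul_comm, ← mul_assoc, ← map_mul, mul_inv_cancel, map_one, one_mul]
  simp_rw [h]
  rw [← Finset.smul_sum, Finset.sum_comm]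
  simp_rw [← Finset.sum_smul]
  rw [Finset.sum_eq_single 1]
  · simp [smul_smul, hcard]
  · intro χ _ hχ
    rw [← Equiv.sum_comp (Equiv.inv G)]
    simp only [Equiv.inv_apply, inv_inv]
    rw [sum_character_eq_zero hχ, zero_smul]
  · simp

/-- In the spanning elements, v_χ is absorbed by `p`, and p u_g p vanishes for g ≠ 1. -/
theorem exists_p_mul_mul_p (c : C) : ∃ b, S.p * c * S.p = S.ι b * S.p := by
  induction c using S.induction_on with
  | h b g χ =>
    have e : S.p * (S.ι b * S.u g * S.v χ) * S.p = S.ι b * (S.p * S.u g * S.p) := by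
      rw [mul_assoc, mul_assoc (S.ι b * S.u g), S.v_mul_p, ← mul_assoc, ← mul_assoc, S.p_mul_ι]
      simp only [mul_assoc]
    rw [e]
    by_cases hg : g = 1
    · exact ⟨b, by rw [hg, map_one, mul_one, S.p_mul_p hcard hinj]⟩
    · exact ⟨0, by rw [S.p_u_p_ne hinj hg, mul_zero, map_zero, zero_mul]⟩
  | hadd x y hx hy =>
    obtain ⟨b, hb⟩ := hx
    obtain ⟨b', hb'⟩ := hy
    exact ⟨b + b', by rw [mul_add, add_mul, hb, hb', map_add, add_mul]⟩

/-- The embedding of `B` in the corner of the idempotent `θ`. -/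
def cornerFun (b : B) : C := (Fintype.card G : k) • (S.θ * S.ι b * S.p * S.θ)

omit hcard hinj in
theorem ρ_cornerFun (g : G) (b : B) : C.ρ g (S.cornerFun b) = S.cornerFun (B.ρ g b) := by
  rw [cornerFun, cornerFun, map_smul, map_mul, map_mul, map_mul, S.ρ_θ, S.ρ_ι]
  -- The action fixes ι(b) but conjugates `p` by u_g⁻¹. The factors u_g are absorbed by the copies
  -- of θ, and passing one across ι(b) replaces b by its image under g.
  have e : S.θ * S.ι b = S.θ * S.ι (B.ρ g b) * S.u g := by
    rw [mul_assoc, ← S.u_ι, ← mul_assoc, S.θ_mul_u]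
  rw [e, mul_assoc _ (S.u g), S.u_mul_ρ_p, mul_assoc, mul_assoc S.p, S.u_mul_θ, ← mul_assoc]

theorem p_mul_cornerFun_mul_p (b : B) :
    S.p * S.cornerFun b * S.p = (Fintype.card G : k)⁻¹ • (S.ι b * S.p) := by
  have h : S.p * (S.θ * S.ι b * S.p * S.θ) * S.p =
      (S.p * S.θ * S.p) * S.ι b * (S.p * S.θ * S.p) := by
    simp only [mul_assoc]
    rw [← mul_assoc S.p (S.ι b), S.p_mul_ι, mul_assoc, ← mul_assoc S.p S.p,
      S.p_mul_p hcard hinj]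
  rw [cornerFun, mul_smul_comm, smul_mul_assoc, h, S.p_θ_p hcard hinj, smul_mul_assoc,
    smul_mul_assoc, mul_smul_comm, smul_smul, smul_smul, S.p_mul_ι, mul_assoc (S.ι b),
    S.p_mul_p hcard hinj, mul_inv_cancel₀ hcard, one_mul]

theorem cornerFun_mul (b b' : B) : S.cornerFun (b * b') = S.cornerFun b * S.cornerFun b' := by
  have h : S.θ * S.ι b * S.p * S.θ * (S.θ * S.ι b' * S.p * S.θ) =
      S.θ * S.ι b * (S.p * S.θ * S.p) * S.ι b' * S.θ := by
    rw [mul_assoc S.θ (S.ι b') S.p, ← S.p_mul_ι]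
    simp only [mul_assoc]
    rw [← mul_assoc S.θ S.θ, S.θ_mul_θ hcard]
  rw [cornerFun, cornerFun, cornerFun, smul_mul_smul_comm, h, S.p_θ_p hcard hinj, mul_smul_comm,
    smul_mul_assoc, smul_mul_assoc, smul_smul, mul_assoc (S.θ * S.ι b), S.p_mul_ι, map_mul,
    mul_inv_cancel_right₀ hcard]
  simp only [mul_assoc]

/-- The algebra `B` is the corner of the idempotent `θ`. -/
theorem isGIso_corner : B.IsGIso (C.corner (S.isIdempotentElem_θ hcard) S.ρ_θ) := by
  have hmem (b : B) : S.cornerFun b ∈ Subsemigroup.corner S.θ := by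
    refine (Subsemigroup.mem_corner_iff (S.isIdempotentElem_θ hcard)).2 ⟨?_, ?_⟩
    · rw [cornerFun, mul_smul_comm]
      simp only [← mul_assoc, S.θ_mul_θ hcard]
    · rw [cornerFun, smul_mul_assoc, mul_assoc _ S.θ, S.θ_mul_θ hcard]
  let f : B →ₐ[k] C.corner (S.isIdempotentElem_θ hcard) S.ρ_θ := AlgHom.ofLinearMap
    { toFun := fun b => (⟨S.cornerFun b, hmem b⟩ : (S.isIdempotentElem_θ hcard).Corner)
      map_add' := fun b b' => C.cornerVal_injective (S.isIdempotentElem_θ hcard) (by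
        change S.cornerFun (b + b') = S.cornerFun b + S.cornerFun b'
        simp only [cornerFun, map_add, mul_add, add_mul, smul_add])
      map_smul' := fun c b => C.cornerVal_injective (S.isIdempotentElem_θ hcard) (by
        change S.cornerFun (c • b) = c • S.cornerFun b
        simp only [cornerFun, map_smul, mul_smul_comm, smul_mul_assoc]
        rw [smul_comm]) }
    (C.cornerVal_injective (S.isIdempotentElem_θ hcard) (by
      change S.cornerFun 1 = S.θ
      rw [cornerFun, map_one, mul_one, S.θ_p_θ hcard, smul_smul, mul_inv_cancel₀ hcard, one_smul]))
    (fun b b' => C.cornerVal_injective (S.isIdempotentElem_θ hcard) (S.cornerFun_mul hcard hinj b b'))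
  have hf (b : B) : C.cornerVal (S.isIdempotentElem_θ hcard) (f b) = S.cornerFun b := rfl
  refine ⟨AlgEquiv.ofBijective f ⟨?_, ?_⟩, fun g b => ?_⟩
  · rw [injective_iff_map_eq_zero]
    intro b hb
    have h1 : S.cornerFun b = 0 := (hf b).symm.trans
      ((congrArg (C.cornerVal (S.isIdempotentElem_θ hcard)) hb).trans (map_zero _))
    have h2 := S.p_mul_cornerFun_mul_p hcard hinj b
    rw [h1, mul_zero, zero_mul, p, mul_smul_comm, smul_smul] at h2
    exact S.ι_mul_sum b ((smul_eq_zero.1 h2.symm).resolve_left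
      (mul_ne_zero (inv_ne_zero hcard) (inv_ne_zero hcard)))
  · intro (c : (S.isIdempotentElem_θ hcard).Corner)
    obtain ⟨hc, hc'⟩ := (Subsemigroup.mem_corner_iff (S.isIdempotentElem_θ hcard)).1 c.2
    obtain ⟨b, hb⟩ := S.exists_p_mul_mul_p hcard hinj c.1
    refine ⟨(Fintype.card G : k) • b, C.cornerVal_injective (S.isIdempotentElem_θ hcard) ?_⟩
    refine (hf _).trans ?_
    change _ = c.1
    -- As c = θcθ, the element θ(pcp)θ equals (θpθ) c (θpθ) = |G|⁻² c. One factor |G| comes from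
    -- `cornerFun`, the other from the chosen preimage.
    have h : S.θ * S.ι b * S.p * S.θ = S.θ * S.p * S.θ * c.1 * (S.θ * S.p * S.θ) := by
      rw [mul_assoc S.θ, ← hb]
      conv_lhs => rw [← hc, ← hc']
      simp only [mul_assoc]
    rw [cornerFun, map_smul, mul_smul_comm, smul_mul_assoc, smul_mul_assoc, h, S.θ_p_θ hcard,
      smul_mul_assoc, smul_mul_assoc, mul_smul_comm, hc, hc', smul_smul, smul_smul, smul_smul]
    have e : (Fintype.card G : k) * Fintype.card G *
        (Fintype.card G : k)⁻¹ * (Fintype.card G : k)⁻¹ = 1 := by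
      field_simp
    exact (congrArg (· • c.1) e).trans (one_smul _ _)
  · refine C.cornerVal_injective (S.isIdempotentElem_θ hcard) ?_
    exact (S.ρ_cornerFun g b).symm

/-- The ideal generated by θ contains |G| pθp = p, and the conjugates of `p` sum to 1. -/
theorem sum_θ_eq_one : ∑ g, ((Fintype.card G : k) • (S.u g * S.p)) * S.θ * (S.p * S.u g⁻¹) = 1 := by
  rw [← S.sum_u_p_u hcard]
  refine Finset.sum_congr rfl fun g _ => ?_
  have h : S.u g * S.p * S.θ * (S.p * S.u g⁻¹) = S.u g * (S.p * S.θ * S.p) * S.u g⁻¹ := by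
    simp only [mul_assoc]
  rw [smul_mul_assoc, smul_mul_assoc, h, S.p_θ_p hcard hinj, mul_smul_comm, smul_mul_assoc,
    smul_smul, mul_inv_cancel₀ hcard, one_smul]

end DoubleSkew

end DoubleSkew

section SkewSkew

variable {k G : Type u} [Field k] [Group G]

theorem inc_injective [Finite G] (A : GAlgebra k G) : Function.Injective A.inc :=
  SkewMonoidAlgebra.single_injective 1

/-- Compare the coefficients at the identity element. -/
theorem eq_zero_of_inc_mul_sum_grp [Fintype G] (A : GAlgebra k G) (a : A)
    (h : A.inc a * ∑ g, A.grp g = 0) : a = 0 := by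
  classical
  rw [Finset.mul_sum] at h
  simp_rw [inc_mul_grp] at h
  have h0 : (∑ g, SkewMonoidAlgebra.single g a : A.SkewGroupRing) = 0 := h
  have h1 := congrArg (fun x => SkewMonoidAlgebra.coeffAddEquiv x 1) h0
  simpa [map_sum, SkewMonoidAlgebra.coeff_single_apply, Finsupp.single_apply] using h1

variable [Fintype G] [Fintype (G →* kˣ)]

/-- The iterated skew-group algebra is generated by the algebra, the group and its characters. -/
noncomputable def doubleSkew (B : GAlgebra k G) : DoubleSkew B B.skewSkew where
  ι := B.skew.inc.comp B.inc
  u := (B.skew.inc : B.skew →* B.skew.skew).comp B.grp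
  v := B.skew.grp
  u_ι g b := by
    change B.skew.inc (B.grp g) * B.skew.inc (B.inc b) =
      B.skew.inc (B.inc (B.ρ g b)) * B.skew.inc (B.grp g)
    rw [← map_mul, grp_mul_inc, map_mul]
  v_ι χ b := by
    change B.skew.grp χ * B.skew.inc (B.inc b) = B.skew.inc (B.inc b) * B.skew.grp χ
    rw [grp_mul_inc, skew_ρ_inc]
  v_u χ g := by
    change B.skew.grp χ * B.skew.inc (B.grp g) =
      ((χ g : kˣ) : k) • (B.skew.inc (B.grp g) * B.skew.grp χ)
    rw [grp_mul_inc, skew_ρ_grp, map_smul, smul_mul_assoc]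
  ρ_ι g b := B.skew.skew_ρ_inc _ _
  ρ_u g h := B.skew.skew_ρ_inc _ _
  ρ_v g χ := B.skew.skew_ρ_grp _ _
  induction_on P c h hadd := by
    refine B.skew.skew_induction (p := P) c (fun a χ => ?_) hadd
    refine B.skew_induction (p := fun a => P (B.skew.inc a * B.skew.grp χ)) a (fun b g => ?_)
      (fun x y hx hy => ?_)
    · rw [map_mul]
      exact h b g χ
    · rw [map_add, add_mul]
      exact hadd _ _ hx hy
  ι_mul_sum b h := by
    have h1 := B.skew.eq_zero_of_inc_mul_sum_grp (B.inc b) h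
    exact (map_eq_zero_iff _ B.inc_injective).1 h1

end SkewSkew

end GAlgebra

theorem corollary2p10 {k G : Type u} [Field k] [CommGroup G] [Finite G]
    (hchar : ¬ ringChar k ∣ Nat.card G) (A B : GAlgebra k G) :
    (A.DerEquiv B → A.skew.DerEquiv B.skew) ∧
    (Function.Bijective (GAlgebra.doubleDual k G) →
      (∃ (θ : A.skewSkew) (hθ : IsIdempotentElem θ) (hG : ∀ g, A.skewSkew.ρ g θ = θ),
        A.IsGIso (A.skewSkew.corner hθ hG)) →
      (∃ (θ' : B.skewSkew) (hθ' : IsIdempotentElem θ') (hG' : ∀ g, B.skewSkew.ρ g θ' = θ'),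
        B.IsGIso (B.skewSkew.corner hθ' hG')) →
      (A.DerEquiv B ↔ A.skew.DerEquiv B.skew)) := by
  have := Fintype.ofFinite G
  have := Fintype.ofFinite (G →* kˣ)
  have hcard : (Fintype.card G : k) ≠ 0 := by
    rw [← Nat.card_eq_fintype_card]
    exact fun h => hchar ((ringChar.spec k _).1 h)
  have h1 (h : A.DerEquiv B) : A.skew.DerEquiv B.skew := (A.indPair hcard).derEquiv B h
  refine ⟨h1, fun hbij _ _ => ⟨h1, fun h => ?_⟩⟩
  -- Restriction carries the tilting object over ΛG to one over Λ; its endomorphism algebra is the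
  -- skew-group algebra of Λ'G, with G acting through its double dual.
  have h2 : A.DerEquiv B.skewSkew := (A.resPair hcard hbij.injective).derEquiv B.skew h
  let S := B.doubleSkew
  exact h2.of_corner (S.isIdempotentElem_θ hcard) S.ρ_θ _ _ (S.sum_θ_eq_one hcard hbij.injective)
    (S.isGIso_corner hcard hbij.injective)
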